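/- **Setting.** A guarded timed automaton (gTA) $A=(Q,\hat q,\mathsf C,\mathcal T,\mathit{Inv})$ has a finite set $Q$ of locations, an initial location $\hat q$, clocks $\mathsf C$, invariants $\mathit{Inv}(q)$ (clock constraints: $\top$, conjunctions, $c\sim c'+d$, $c\sim d$ with constants $d\ge 0$ and $\sim\,\in\{<,\le,=,\ge,>\}$), and transitions $(q,g,r,\gamma,q')$ with clock guard $g$, reset set $r\subseteq\mathsf C$ and location guard $\gamma\in Q\cup\{\top\}$. In addition every location has a stuttering transition $\epsilon=(q,\top,\emptyset,\top,q)$. In the network $A^n$ of $n$ copies (processes) of $A$, time elapses synchronously (respecting all invariants), and process $i$ may take a transition with location guard $\gamma\ne\top$ only if some process $j\ne i$ is in $\gamma$. $\mathcal L(A^n)$ is the set of all finite and infinite sequences of delay-plus-discrete steps from the initial configuration $(\hat q,\mathbf 0)^n$. $\mathcal L|_{[1,m]}(A^n)$ is its projection to the first $m$ processes, where a discrete step of another process becomes a stuttering step of one of the first $m$ processes; it is taken up to stuttering, i.e. it consists of all sequences of which some stuttering expansion (each step is split into finitely many stuttering steps followed by the original discrete step, with the same total delay) is such a projection. $\mathcal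 L|_{[1,m]}(A^\infty)=\bigcup_{n\ge m,\,n>0}\mathcal L|_{[1,m]}(A^n)$. A number $c$ is a *cutoff* for $A$ and $m$ if $\mathcal L|_{[1,m]}(A^\infty)=\mathcal L|_{[1,m]}(A^c)$. $\mathit{RGuards}(A)$ is the set of locations that occur as a location guard in $A$ and are reachable in some $A^n$, $n>0$. For a location $q$, $\delta(q)$ denotes the minimal time at which some process is in $q$ in some computation of some $A^n$, $n>0$. The summary automaton $\hat A$ has the same locations and invariants and an additional clock $t$ that is never reset; its transitions are those $(q,g,r,\gamma,q')$ of $A$ for which $\gamma=\top$ or $\gamma$ is reachable in some $A^n$, where a guard $\gamma\neq\top$ is replaced by the clock constraint $t\ge\delta(\gamma)$. **Statement.** Let $A$ be a gTA with a single clock $x$. Suppose that $\mathit{RGuards}(A)$ can be ordered (by a rank function $Q\to\mathbb N$) such that each $q\in \mathit{RGuards}(A)$ is reached by a finite computation $\rho_q$ of $\hat A$ with total delay exactly $\delta(q)$ all of whose transitions come from transitions of $A$ with a location guard that is trivial or of strictly smaller rank than $q$. Suppose further that for every $q\in \mathit{RGuards}(A)$ with $\mathit{Inv}(q)\neq\top$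 there is a loop $\psi=q_0\xrightarrow{\tau_0}q_1\cdots\xrightarrow{\tau_{l-1}}q_l$ of $\hat A$, $q_0=q_l=q$, containing at least one reset of $x$, with first resetting transition $\tau_i$ and last resetting transition $\tau_j$, such that the following holds. * Let $v_0$ be the clock valuation at the end of $\rho_q$. Then $\psi$ can be executed from $(q,v_0)$ as soon as possible, i.e. with each delay $\delta_k$ the least one (which exists) after which $\tau_k$ can be taken. Put $d_1=\sum_{k\le i}\delta_k$, $d_2=\sum_{i<k\le j}\delta_k$, $d_3=\sum_{j<k<l}\delta_k$. * Let $T$ be the minimum of the upper bounds that the invariants $\mathit{Inv}(q_k)$ and the clock guards of the $A$-transitions underlying $\tau_k$, $0\le k\le i$, impose on $x$. Then $T$ is finite and attained, i.e. $x=T$ satisfies all these invariants and clock guards. * $T\ge d_1+d_2+d_3+v_0(x)$ and $T>d_3$. For every $q\in\mathit{RGuards}(A)$ let $w(q)=1$ if $\mathit{Inv}(q)=\top$, and otherwise $w(q)=\max\{2,\lceil\frac{T+d_2}{T-d_3}\rceil\}$ with $T,d_2,d_3$ from a chosen such $\rho_q$ and $\psi$. Then for every $m\in\mathbb N$ the number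 $$m+\sum_{q\in \mathit{RGuards}(A)}w(q)$$ is a cutoff for $A$ and $m$. -/

import Mathlib

open scoped NNReal ENNReal

/-! ## Clock constraints -/

/-- The comparison operators `<, ≤, =, ≥, >`. -/
inductive ClockRel : Type
  | lt | le | eq | ge | gt

/-- Interpretation of a comparison operator on clock values. -/
def ClockRel.Holds : ClockRel → ℝ≥0 → ℝ≥0 → Prop
  | .lt, a, b => a < b
  | .le, a, b => a ≤ b
  | .eq, a, b => a = b
  | .ge, a, b => b ≤ a
  | .gt, a, b => b < a

/-- Clock constraints over the clocks `C`: `⊤`, conjunctions, `c ∼ c' + d` and `c ∼ d`.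
The constants may be any non-negative reals (natural numbers are a special case), so that the
minimal reachability times, which occur in the summary automaton, are constants as well. -/
inductive ClockConstraint (C : Type*) : Type _
  | top : ClockConstraint C
  | and : ClockConstraint C → ClockConstraint C → ClockConstraint C
  | diff : C → ClockRel → C → ℝ≥0 → ClockConstraint C
  | bound : C → ClockRel → ℝ≥0 → ClockConstraint C

namespace ClockConstraint

/-- `φ.Sat v`: the clock valuation `v` satisfies `φ`. -/
def Sat {C : Type*} : ClockConstraint C → (C → ℝ≥0) → Prop
  | .top, _ => True
  | .and φ χ, v => φ.Sat v ∧ χ.Sat v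
  | .diff c r c' d, v => r.Holds (v c) (v c' + d)
  | .bound c r d, v => r.Holds (v c) d

/-- Renaming of the clocks. -/
def map {C D : Type*} (f : C → D) : ClockConstraint C → ClockConstraint D
  | .top => .top
  | .and φ χ => .and (φ.map f) (χ.map f)
  | .diff c r c' d => .diff (f c) r (f c') d
  | .bound c r d => .bound (f c) r d

/-- The upper bound (possibly `∞`) that a constraint imposes on the value of the clock `x`, for
constraints over a single clock `x`: the supremum of the clock values that satisfy it. -/
noncomputable def upperBound {C : Type*} (φ : ClockConstraint C) : ℝ≥0∞ :=
  ⨆ (r : ℝ≥0) (_ : φ.Sat (fun _ => r)), (r : ℝ≥0∞)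

end ClockConstraint

/-! ## Timed paths -/

/-- A finite or infinite sequence `conf 0 --(delay 0, label 0)--> conf 1 --(delay 1, label 1)--> …`
with `len` steps. Only `delay k`, `label k` for `k < len` and `conf k` for `k ≤ len` are meaningful;
all notions below depend on these entries only. -/
structure TimedPath (S L : Type*) where
  len : ℕ∞
  conf : ℕ → S
  delay : ℕ → ℝ≥0
  label : ℕ → L

namespace TimedPath

variable {S L : Type*}

/-- Total time delay of the first `k` steps. -/
noncomputable def elapsed (ρ : TimedPath S L) (k : ℕ) : ℝ≥0 := ∑ i ∈ Finset.range k, ρ.delay i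

/-- Every step of the sequence is a step of the given transition relation. -/
def Follows (step : S → ℝ≥0 → L → S → Prop) (ρ : TimedPath S L) : Prop :=
  ∀ k : ℕ, (k : ℕ∞) < ρ.len → step (ρ.conf k) (ρ.delay k) (ρ.label k) (ρ.conf (k + 1))

/-- The maximal prefix of `ρ` with total delay at most `d` is finite and has exactly `k` steps. -/
def PrefixLength (ρ : TimedPath S L) (d : ℝ≥0) (k : ℕ) : Prop :=
  IsGreatest {j : ℕ | (j : ℕ∞) ≤ ρ.len ∧ ρ.elapsed j ≤ d} k

/-- `ρ.IsStutterExpansion stutter ρ'`: `ρ'` arises from `ρ` by inserting stuttering steps, i.e. by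
splitting each step `(δ, a)` of `ρ` into finitely many stuttering steps followed by a step with
label `a`, with total delay `δ`. Step `k` of `ρ` corresponds to step `f k` of `ρ'`. -/
def IsStutterExpansion (stutter : L → Prop) (ρ ρ' : TimedPath S L) : Prop :=
  ρ'.conf 0 = ρ.conf 0 ∧ ∃ f : ℕ → ℕ, StrictMono f ∧
    (∀ k : ℕ, (k : ℕ∞) < ρ.len → (f k : ℕ∞) < ρ'.len ∧ ρ'.label (f k) = ρ.label k ∧
      ρ'.elapsed (f k + 1) = ρ.elapsed (k + 1) ∧ ρ'.conf (f k + 1) = ρ.conf (k + 1)) ∧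
    (∀ j : ℕ, (j : ℕ∞) < ρ'.len →
      (∃ k : ℕ, (k : ℕ∞) < ρ.len ∧ j ≤ f k) ∧
      ((∀ k : ℕ, (k : ℕ∞) < ρ.len → f k ≠ j) → stutter (ρ'.label j)))

end TimedPath

/-! ## Guarded timed automata -/

/-- A transition `(q, g, r, γ, q')`; the location guard `γ` is `none` for the trivial guard `⊤`. -/
structure Transition (Q C : Type*) where
  src : Q
  guard : ClockConstraint C
  reset : Set C
  locGuard : Option Q
  tgt : Q

/-- The stuttering transition `ε = (q, ⊤, ∅, ⊤, q)`. -/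
def Transition.stutter {Q C : Type*} (q : Q) : Transition Q C := ⟨q, .top, ∅, none, q⟩

/-- Being one of the stuttering transitions. -/
def Transition.IsStutter {Q C : Type*} (τ : Transition Q C) : Prop :=
  ∃ q, τ = Transition.stutter q

/-- A guarded timed automaton with locations `Q` and clocks `C`. -/
structure GTA (Q C : Type*) where
  init : Q
  trans : Set (Transition Q C)
  inv : Q → ClockConstraint C

/-- A configuration: a location and a clock valuation. -/
@[ext] structure Config (Q C : Type*) where
  loc : Q
  val : C → ℝ≥0

/-- Passing of `δ` time units. -/
def Config.wait {Q C : Type*} (s : Config Q C) (δ : ℝ≥0) : Config Q C :=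
  ⟨s.loc, fun c => s.val c + δ⟩

namespace GTA

variable {Q C : Type*}

/-- The initial configuration. -/
def initConfig (A : GTA Q C) : Config Q C := ⟨A.init, fun _ => 0⟩

/-- The set `Guards(A)` of non-trivial location guards. -/
def guards (A : GTA Q C) : Set Q := {γ | ∃ τ ∈ A.trans, τ.locGuard = some γ}

/-- A delay of `δ` is possible: the invariant holds until the end of the delay. -/
def CanWait (A : GTA Q C) (s : Config Q C) (δ : ℝ≥0) : Prop :=
  ∀ δ' ≤ δ, (A.inv s.loc).Sat (s.wait δ').val

open Classical in
/-- Discrete transition `s →^τ s'` of a single automaton, ignoring the location guard; the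
stuttering transitions are available in every automaton. -/
def Fires (A : GTA Q C) (s : Config Q C) (τ : Transition Q C) (s' : Config Q C) : Prop :=
  (τ ∈ A.trans ∨ τ.IsStutter) ∧ s.loc = τ.src ∧ τ.guard.Sat s.val ∧ s'.loc = τ.tgt ∧
    (∀ c, s'.val c = if c ∈ τ.reset then 0 else s.val c) ∧ (A.inv s'.loc).Sat s'.val

/-- A delay followed by a discrete transition of a single automaton, ignoring location guards. -/
def Step (A : GTA Q C) (s : Config Q C) (δ : ℝ≥0) (τ : Transition Q C) (s' : Config Q C) : Prop :=
  A.CanWait s δ ∧ A.Fires (s.wait δ) τ s'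

/-! ### Networks -/

/-- A delay `δ` followed by a discrete transition `τ` of process `i` in the network `A ^ n`. The
location guard of `τ` has to be occupied by a process other than `i`. -/
def NStep (A : GTA Q C) (n : ℕ) (c : Fin n → Config Q C) (δ : ℝ≥0) (a : Fin n × Transition Q C)
    (c' : Fin n → Config Q C) : Prop :=
  (∀ i, A.CanWait (c i) δ) ∧ A.Fires ((c a.1).wait δ) a.2 (c' a.1) ∧
    (∀ γ, a.2.locGuard = some γ → ∃ j, j ≠ a.1 ∧ (c j).loc = γ) ∧
    ∀ j, j ≠ a.1 → c' j = (c j).wait δ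

/-- Timed sequences over the configurations and actions of networks with `n` processes. -/
abbrev NPath (Q C : Type*) (n : ℕ) := TimedPath (Fin n → Config Q C) (Fin n × Transition Q C)

/-- The language `𝓛(A ^ n)`: all finite and infinite computations of `A ^ n`. -/
def language (A : GTA Q C) (n : ℕ) : Set (NPath Q C n) :=
  {π | π.conf 0 = (fun _ => A.initConfig) ∧ π.Follows (A.NStep n)}

/-- `ρ` is a projection of `π` to the first `m` processes: a discrete transition of a process
outside `[1, m]` is replaced by a stuttering transition of any of the first `m` processes. -/
def IsProjection {m n : ℕ} (h : m ≤ n) (π : NPath Q C n) (ρ : NPath Q C m) : Prop :=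
  ρ.len = π.len ∧
    (∀ k : ℕ, (k : ℕ∞) ≤ π.len → ∀ i : Fin m, ρ.conf k i = π.conf k (Fin.castLE h i)) ∧
    ∀ k : ℕ, (k : ℕ∞) < π.len → ρ.delay k = π.delay k ∧
      ((Fin.castLE h (ρ.label k).1 = (π.label k).1 ∧ (ρ.label k).2 = (π.label k).2) ∨
       ((∀ i : Fin m, Fin.castLE h i ≠ (π.label k).1) ∧
          (ρ.label k).2 = Transition.stutter (ρ.conf k (ρ.label k).1).loc))

/-- The projected language `𝓛|_[1,m](A ^ n)`, as usual up to stuttering: a sequence belongs to it if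
some stuttering expansion of it is a projection of a computation of `A ^ n`. -/
def projLanguage (A : GTA Q C) (m n : ℕ) : Set (NPath Q C m) :=
  {ρ | ∃ h : m ≤ n, ∃ π ∈ A.language n, ∃ ρ' : NPath Q C m, IsProjection h π ρ' ∧
    ρ.IsStutterExpansion (fun a => a.2.IsStutter) ρ'}

/-- The projected language `𝓛|_[1,m](A ^ ∞)` of the disjunctive timed network of `A`. -/
def projLanguageInf (A : GTA Q C) (m : ℕ) : Set (NPath Q C m) :=
  ⋃ n : {n : ℕ // 0 < n}, A.projLanguage m n

/-- `c` is a cutoff for the family `F` and `m` processes. -/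
def IsCutoff (F : Set (GTA Q C)) (m c : ℕ) : Prop :=
  ∀ A ∈ F, A.projLanguageInf m = A.projLanguage m c

/-- The locations that are reachable in `A ^ n` for some `n > 0`. -/
def reachInf (A : GTA Q C) : Set Q :=
  {q | ∃ n : ℕ, 0 < n ∧ ∃ π ∈ A.language n, ∃ k : ℕ, (k : ℕ∞) ≤ π.len ∧ ∃ i, (π.conf k i).loc = q}

/-- The reachable guard locations `RGuards(A)`. -/
def rGuards (A : GTA Q C) : Set Q := A.guards ∩ A.reachInf

open Classical in
/-- `RGuards(A)` as a finite set. -/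
noncomputable def rGuardsFinset [Fintype Q] (A : GTA Q C) : Finset Q :=
  Finset.univ.filter (fun q => q ∈ A.rGuards)

/-- The times `d` such that some computation `π` of some `A ^ n` occupies `q` in the last
configuration of its maximal prefix of duration at most `d`. -/
def reachTimes (A : GTA Q C) (q : Q) : Set ℝ≥0 :=
  {d | ∃ n : ℕ, 0 < n ∧ ∃ π ∈ A.language n, ∃ k : ℕ, π.PrefixLength d k ∧ ∃ i, (π.conf k i).loc = q}

/-- The minimal reachability time of `q` in `A ^ ∞` (meaningful when the minimum exists). -/
noncomputable def minReach (A : GTA Q C) (q : Q) : ℝ≥0 := sInf (A.reachTimes q)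

/-! ### The summary automaton

Its clocks are those of `A` (as `some c`) and a global clock `t` (as `none`). -/

/-- The transition `τ̂` of the summary automaton: a location guard `γ` is replaced by the clock
constraint `t ≥ minReach γ`. -/
noncomputable def summaryTrans (A : GTA Q C) (τ : Transition Q C) : Transition Q (Option C) where
  src := τ.src
  guard := match τ.locGuard with
    | none => τ.guard.map some
    | some γ => .and (τ.guard.map some) (.bound none .ge (A.minReach γ))
  reset := some '' τ.reset
  locGuard := none
  tgt := τ.tgt

/-- The transitions of `A` that are kept: those whose location guard is trivial or reachable. -/
def keptTrans (A : GTA Q C) : Set (Transition Q C) :=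
  {τ | τ ∈ A.trans ∧ ∀ γ, τ.locGuard = some γ → γ ∈ A.reachInf}

/-- The summary automaton `Â`. -/
noncomputable def summary (A : GTA Q C) : GTA Q (Option C) where
  init := A.init
  trans := A.summaryTrans '' A.keptTrans
  inv := fun q => (A.inv q).map some

/-- A step of the summary automaton, labelled with the transition `τ` of `A` it comes from. -/
def SummaryStep (A : GTA Q C) (s : Config Q (Option C)) (δ : ℝ≥0) (τ : Transition Q C)
    (s' : Config Q (Option C)) : Prop :=
  τ ∈ A.keptTrans ∧ A.summary.Step s δ (A.summaryTrans τ) s'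

/-- Timed sequences of the summary automaton. -/
abbrev SummaryPath (Q C : Type*) := TimedPath (Config Q (Option C)) (Transition Q C)

/-- `ρ` is a computation of the summary automaton with `n` steps that reaches `q` at its minimal
reachability time, and uses only location guards that come before `q` in the order given by
`ord`. -/
def IsMinimalRun (A : GTA Q C) (ord : Q → ℕ) (q : Q) (ρ : SummaryPath Q C) (n : ℕ) : Prop :=
  ρ.len = n ∧ ρ.conf 0 = A.summary.initConfig ∧ ρ.Follows A.SummaryStep ∧
    (ρ.conf n).loc = q ∧ ρ.elapsed n = A.minReach q ∧
    ∀ k < n, ∀ γ, (ρ.label k).locGuard = some γ → ord γ < ord q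

/-- `ρ` executes a path of the summary automaton as soon as possible: each delay is the least one
for which the next transition of the path can be taken. -/
def IsAsap (A : GTA Q C) (ρ : SummaryPath Q C) : Prop :=
  ρ.Follows A.SummaryStep ∧ ∀ k : ℕ, (k : ℕ∞) < ρ.len →
    IsLeast {δ | ∃ s', A.SummaryStep (ρ.conf k) δ (ρ.label k) s'} (ρ.delay k)

/-- A lasso of the summary automaton that satisfies the sufficient conditions for a flooding
computation for `q` (one-clock automata). -/
structure FloodingLasso [Unique C] (A : GTA Q C) (ord : Q → ℕ) (q : Q) where
  /-- The stem `ρ₀`, with `n` steps. -/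
  stem : SummaryPath Q C
  n : ℕ
  stem_minimal : A.IsMinimalRun ord q stem n
  /-- The as-soon-as-possible execution, from the final configuration of the stem, of a loop `ψ`
  with transitions `loop.label 0, …, loop.label (l - 1)`. -/
  loop : SummaryPath Q C
  l : ℕ
  loop_len : loop.len = l
  loop_start : loop.conf 0 = stem.conf n
  loop_asap : A.IsAsap loop
  loop_end : (loop.conf l).loc = q
  /-- The indices of the first and of the last resetting transition. -/
  first : ℕ
  last : ℕ
  first_le_last : first ≤ last
  last_lt : last < l
  first_reset : (loop.label first).reset.Nonempty
  last_reset : (loop.label last).reset.Nonempty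
  before_first : ∀ k < first, (loop.label k).reset = ∅
  after_last : ∀ k, last < k → k < l → (loop.label k).reset = ∅
  /-- `T` is the least upper bound imposed on the clock by the invariants and clock guards that have
  to be passed up to and including the first reset, and these bounds are not strict. -/
  T : ℝ≥0
  T_eq : (T : ℝ≥0∞) = ⨅ k ∈ Set.Iic first,
    min (A.inv (loop.label k).src).upperBound (loop.label k).guard.upperBound
  T_attained : ∀ k ≤ first,
    (A.inv (loop.label k).src).Sat (fun _ => T) ∧ (loop.label k).guard.Sat (fun _ => T)
  /-- `T ≥ d₁ + d₂ + d₃ + v₀(x)`. -/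
  total_le : (∑ k ∈ Finset.Ico 0 (first + 1), loop.delay k) +
      (∑ k ∈ Finset.Ico (first + 1) (last + 1), loop.delay k) +
      (∑ k ∈ Finset.Ico (last + 1) l, loop.delay k) + (stem.conf n).val (some default) ≤ T
  /-- `T > d₃`. -/
  tail_lt : ∑ k ∈ Finset.Ico (last + 1) l, loop.delay k < T

namespace FloodingLasso

variable [Unique C] {A : GTA Q C} {ord : Q → ℕ} {q : Q}

/-- The time `d₂` from the first to the last reset. -/
noncomputable def d₂ (L : A.FloodingLasso ord q) : ℝ≥0 :=
  ∑ k ∈ Finset.Ico (L.first + 1) (L.last + 1), L.loop.delay k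

/-- The time `d₃` from the last reset to the end of the loop. -/
noncomputable def d₃ (L : A.FloodingLasso ord q) : ℝ≥0 :=
  ∑ k ∈ Finset.Ico (L.last + 1) L.l, L.loop.delay k

/-- `max {2, ⌈(T + d₂) / (T - d₃)⌉}`. -/
noncomputable def width (L : A.FloodingLasso ord q) : ℕ :=
  max 2 ⌈((L.T : ℝ) + (L.d₂ : ℝ)) / ((L.T : ℝ) - (L.d₃ : ℝ))⌉₊

end FloodingLasso

open Classical in
/-- The width `w(q)`: `1` if `q` has no invariant, and the width of the given lasso otherwise (the
last branch concerns locations outside `RGuards(A)` only). -/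
noncomputable def width [Unique C] (A : GTA Q C) {ord : Q → ℕ}
    (lasso : ∀ q ∈ A.rGuards, A.inv q ≠ .top → A.FloodingLasso ord q) (q : Q) : ℕ :=
  if hi : A.inv q = .top then 1
  else if hq : q ∈ A.rGuards then (lasso q hq hi).width else 0

end GTA

/-!
Let `c = m + ∑ w(q)`. Only the inclusion of the projected languages of all networks in the one of
`A ^ c` needs an argument. Given a computation of some `A ^ n`, the first `m` processes of `A ^ c`
repeat their steps, and all other processes are replaced by `w(q)` processes for each reachable
guard `q` that keep `q` occupied from time `minReach q` on. A guard is never needed earlier than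
that, by definition of `minReach`.

If `q` has no invariant, one process runs the given stem and then idles in `q`. Otherwise put
`s = T - d₃` and `e = d₂ + d₃`. All `w(q)` processes reach `q` by the stem and then go through the
loop forever, taking its steps up to the first reset at once, as late as possible, when the clock is
`T`. This is allowed because clock constraints over one clock define intervals
(`FloodingLasso.fires_of_le_first`). A round takes the time `s + e`, of which `s` is spent in `q`.
The first rounds are started at different times, such that process `k + 1` comes back exactly when
process `k` leaves. There is room for this because `T ≥ d₁ + d₂ + d₃ + v₀`, and `w(q) * s ≥ s + e`
makes process `0` come back in time for the departure of the last process
(`exists_between_departures`).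

Many events take place at the same instant and need each other's location guards, so the order
within an instant matters. Each event has a key `(time, priority)`, ordered lexicographically. Stems
come first, by rank; then steps of rounds that started earlier; then departures, one process of each
location after the other. A guard is available at a key if some process is in the guard location and
has no event with that very key (`Script.Occupies`), so ties can be broken arbitrarily. Executing
the events greedily by least key (`Merge`) turns the given run and the scripts of the flooding
processes into a computation of the network (`mem_projLanguage_of_scripts`); its projection is a
stuttering expansion of the given run, and stuttering expansions compose.
-/

/-! ### Merging finitely many monotone sequences -/

namespace Merge

variable {O K : Type*} [Fintype O] [Nonempty O] [LinearOrder K] (κ : O → ℕ → K)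

/-- A track whose next key is least, when `s o` keys of each track `o` have been consumed. -/
noncomputable def leastTrack (s : O → ℕ) : O :=
  Classical.choose (Finite.exists_min fun o => κ o (s o))

theorem leastTrack_le (s : O → ℕ) (o : O) : κ (leastTrack κ s) (s (leastTrack κ s)) ≤ κ o (s o) :=
  Classical.choose_spec (Finite.exists_min fun o => κ o (s o)) o

variable [DecidableEq O]

/-- The number of keys of each track consumed by the first `j` steps of the greedy merge. -/
noncomputable def count : ℕ → O → ℕ
  | 0 => fun _ => 0
  | j + 1 => Function.update (count j) (leastTrack κ (count j))
      (count j (leastTrack κ (count j)) + 1)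

/-- The track that step `j` of the greedy merge advances. -/
noncomputable def track (j : ℕ) : O := leastTrack κ (count κ j)

/-- The key consumed by step `j` of the greedy merge. -/
noncomputable def key (j : ℕ) : K := κ (track κ j) (count κ j (track κ j))

theorem key_le (j : ℕ) (o : O) : key κ j ≤ κ o (count κ j o) := leastTrack_le κ _ o

theorem count_succ_self (j : ℕ) : count κ (j + 1) (track κ j) = count κ j (track κ j) + 1 := by
  simp [count, track]

theorem count_succ_of_ne {j : ℕ} {o : O} (h : o ≠ track κ j) :
    count κ (j + 1) o = count κ j o := by
  simp only [count]
  exact Function.update_of_ne h _ _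

theorem count_mono (o : O) : Monotone fun j => count κ j o := by
  refine monotone_nat_of_le_succ fun j => ?_
  by_cases h : o = track κ j
  · subst h
    rw [count_succ_self]
    exact Nat.le_succ _
  · rw [count_succ_of_ne κ h]

theorem sum_count (j : ℕ) : ∑ o, count κ j o = j := by
  induction j with
  | zero => simp [count]
  | succ j ih =>
    rw [← Finset.add_sum_erase _ _ (Finset.mem_univ (track κ j))] at ih ⊢
    rw [count_succ_self, Finset.sum_congr rfl fun o ho =>
      count_succ_of_ne κ (Finset.ne_of_mem_erase ho)]
    omega

variable {κ}

theorem key_mono (hκ : ∀ o, Monotone (κ o)) : Monotone (key κ) := by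
  refine monotone_nat_of_le_succ fun j => ?_
  by_cases h : track κ (j + 1) = track κ j
  · unfold key
    rw [h, count_succ_self]
    exact hκ _ (Nat.le_succ _)
  · refine (key_le κ j (track κ (j + 1))).trans_eq ?_
    rw [← count_succ_of_ne κ h, key]

theorem le_key (hκ : ∀ o, Monotone (κ o)) {j k : ℕ} {o : O} (hk : k < count κ j o) :
    κ o k ≤ key κ j := by
  induction j with
  | zero => simp [count] at hk
  | succ j ih =>
    refine le_trans ?_ (key_mono hκ (Nat.le_succ j))
    by_cases h : o = track κ j
    · subst h
      rw [count_succ_self] at hk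
      exact hκ _ (Nat.lt_succ_iff.1 hk)
    · rw [count_succ_of_ne κ h] at hk
      exact ih hk

/-- If the key of step `j` lies strictly between two consecutive keys of a track, then exactly the
smaller ones have been consumed, no matter how ties are broken. -/
theorem count_eq (hκ : ∀ o, Monotone (κ o)) {j n : ℕ} {o : O} (h₁ : ∀ k < n, κ o k < key κ j)
    (h₂ : key κ j < κ o n) : count κ j o = n := by
  rcases lt_trichotomy (count κ j o) n with h | h | h
  · exact absurd (key_le κ j o) (h₁ _ h).not_ge
  · exact h
  · exact absurd (le_key hκ h) h₂.not_ge

theorem exists_lt_count (hκ : ∀ o, Monotone (κ o)) {o : O}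
    (h : ∀ n o', o' ≠ o → ∃ k, κ o n < κ o' k) (n : ℕ) : ∃ j, n < count κ j o := by
  by_contra! hn
  have hex : ∀ o', ∃ b, ∀ j, count κ j o' ≤ b := by
    intro o'
    by_cases ho : o' = o
    · exact ⟨n, ho ▸ hn⟩
    · obtain ⟨k, hk⟩ := h n o' ho
      refine ⟨k, fun j => ?_⟩
      by_contra! hlt
      exact absurd ((hk.trans_le (le_key hκ hlt)).trans_le (key_le κ j o)) (hκ o (hn j)).not_gt
  choose b hb using hex
  have := Finset.sum_le_sum fun o' (_ : o' ∈ Finset.univ) => hb o' (∑ o, b o + 1)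
  rw [sum_count] at this
  omega

theorem exists_track_eq (hκ : ∀ o, Monotone (κ o)) {o : O}
    (h : ∀ n o', o' ≠ o → ∃ k, κ o n < κ o' k) (n : ℕ) : ∃ j, track κ j = o ∧ count κ j o = n := by
  classical
  have hex := exists_lt_count hκ h n
  obtain ⟨j, hj⟩ : ∃ j, Nat.find hex = j + 1 := by
    refine Nat.exists_eq_succ_of_ne_zero fun h0 => ?_
    have := Nat.find_spec hex
    rw [h0] at this
    simp [count] at this
  have h1 : n < count κ (j + 1) o := hj ▸ Nat.find_spec hex
  have h2 : count κ j o ≤ n := not_lt.1 (Nat.find_min hex (by omega))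
  have ho : o = track κ j := by
    by_contra hne
    rw [count_succ_of_ne κ hne] at h1
    omega
  subst ho
  rw [count_succ_self] at h1
  exact ⟨j, rfl, by omega⟩

/-- The time at which step `j` of the merge starts, for keys whose first component is a time. -/
noncomputable def time {O : Type*} [Fintype O] [DecidableEq O] [Nonempty O]
    (κ : O → ℕ → ℝ≥0 ×ₗ ℕ) : ℕ → ℝ≥0
  | 0 => 0
  | j + 1 => (ofLex (key κ j)).1

section Time

variable {κ : O → ℕ → ℝ≥0 ×ₗ ℕ}

theorem time_mono (hκ : ∀ o, Monotone (κ o)) : Monotone (time κ) := by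
  refine monotone_nat_of_le_succ fun j => ?_
  cases j with
  | zero => exact zero_le
  | succ j => exact Prod.Lex.monotone_fst _ _ (key_mono hκ (Nat.le_succ j))

theorem time_succ_le {e : O → ℕ → ℝ≥0} (he : ∀ o k, (ofLex (κ o k)).1 = e o (k + 1)) (j : ℕ)
    (o : O) : time κ (j + 1) ≤ e o (count κ j o + 1) :=
  (Prod.Lex.monotone_fst _ _ (key_le κ j o)).trans_eq (he _ _)

theorem time_succ_eq {e : O → ℕ → ℝ≥0} (he : ∀ o k, (ofLex (κ o k)).1 = e o (k + 1)) (j : ℕ) :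
    time κ (j + 1) = e (track κ j) (count κ j (track κ j) + 1) :=
  he _ _

theorem le_time (hκ : ∀ o, Monotone (κ o)) {e : O → ℕ → ℝ≥0} (h0 : ∀ o, e o 0 = 0)
    (he : ∀ o k, (ofLex (κ o k)).1 = e o (k + 1)) (j : ℕ) (o : O) :
    e o (count κ j o) ≤ time κ j := by
  induction j with
  | zero => simp [count, h0]
  | succ j ih =>
    by_cases h : o = track κ j
    · subst h
      rw [count_succ_self, time_succ_eq he]
    · rw [count_succ_of_ne κ h]
      exact ih.trans (time_mono hκ (Nat.le_succ j))

end Time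

end Merge

/-! ### Elementary facts on timed paths and waiting -/

namespace TimedPath

variable {S L : Type*}

theorem elapsed_zero (ρ : TimedPath S L) : ρ.elapsed 0 = 0 := by simp [elapsed]

theorem elapsed_succ (ρ : TimedPath S L) (k : ℕ) :
    ρ.elapsed (k + 1) = ρ.elapsed k + ρ.delay k := by
  simp [elapsed, Finset.sum_range_succ]

theorem elapsed_mono (ρ : TimedPath S L) : Monotone ρ.elapsed :=
  monotone_nat_of_le_succ fun k => by
    rw [elapsed_succ]
    exact le_self_add

theorem IsStutterExpansion.trans {stutter : L → Prop} {ρ₁ ρ₂ ρ₃ : TimedPath S L}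
    (h₁ : ρ₁.IsStutterExpansion stutter ρ₂) (h₂ : ρ₂.IsStutterExpansion stutter ρ₃) :
    ρ₁.IsStutterExpansion stutter ρ₃ := by
  obtain ⟨h0, f, hf, hf1, hf2⟩ := h₁
  obtain ⟨h0', g, hg, hg1, hg2⟩ := h₂
  refine ⟨h0'.trans h0, g ∘ f, hg.comp hf, fun k hk => ?_, fun j hj => ⟨?_, fun hne => ?_⟩⟩
  · obtain ⟨a1, a2, a3, a4⟩ := hf1 k hk
    obtain ⟨b1, b2, b3, b4⟩ := hg1 _ a1
    exact ⟨b1, b2.trans a2, b3.trans a3, b4.trans a4⟩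
  · obtain ⟨⟨k, hk, hjk⟩, -⟩ := hg2 j hj
    obtain ⟨⟨i, hi, hki⟩, -⟩ := hf2 k hk
    exact ⟨i, hi, hjk.trans (hg.monotone hki)⟩
  · obtain ⟨-, hst⟩ := hg2 j hj
    by_cases hex : ∃ k : ℕ, (k : ℕ∞) < ρ₂.len ∧ g k = j
    · obtain ⟨k, hk, rfl⟩ := hex
      rw [(hg1 k hk).2.1]
      refine (hf2 k hk).2 fun i hi hik => hne i hi ?_
      rw [← hik, Function.comp]
    · push Not at hex
      exact hst hex

end TimedPath

namespace Config

variable {Q C : Type*}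

theorem wait_zero (s : Config Q C) : s.wait 0 = s := by
  ext <;> simp [wait]

theorem wait_wait (s : Config Q C) (a b : ℝ≥0) : (s.wait a).wait b = s.wait (a + b) := by
  ext <;> simp [wait, add_assoc]

end Config

namespace GTA

variable {Q C : Type*} {A : GTA Q C}

theorem CanWait.of_add {s : Config Q C} {a b d : ℝ≥0} (h : A.CanWait s d) (hd : a + b ≤ d) :
    A.CanWait (s.wait a) b := by
  intro δ hδ
  rw [Config.wait_wait]
  exact h (a + δ) ((add_le_add_right hδ a).trans hd)

theorem CanWait.sat {s : Config Q C} {d : ℝ≥0} (h : A.CanWait s d) : (A.inv s.loc).Sat s.val := by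
  have := h 0 zero_le
  rwa [Config.wait_zero] at this

theorem fires_stutter {s : Config Q C} (h : (A.inv s.loc).Sat s.val) :
    A.Fires s (Transition.stutter s.loc) s :=
  ⟨Or.inr ⟨_, rfl⟩, rfl, trivial, rfl, by simp [Transition.stutter], h⟩

/-! ### Running a group of scripted processes next to given ones -/

/-- An infinite timed run of one process from `s₀`, ignoring location guards, whose total time is
unbounded. The priorities `prio` order the events of several such processes that take place at the
same time: the `k`-th event has the key `(time, prio k)`. -/
structure Script (A : GTA Q C) (s₀ : Config Q C) where
  path : TimedPath (Config Q C) (Transition Q C)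
  prio : ℕ → ℕ
  start : path.conf 0 = s₀
  step : ∀ k, A.Step (path.conf k) (path.delay k) (path.label k) (path.conf (k + 1))
  mono : Monotone fun k => (toLex (path.elapsed (k + 1), prio k) : ℝ≥0 ×ₗ ℕ)
  unbounded : ∀ t, ∃ k, t < path.elapsed (k + 1)

/-- The key `(time, priority)` of the `k`-th event. -/
noncomputable def Script.key {s₀ : Config Q C} (S : A.Script s₀) (k : ℕ) : ℝ≥0 ×ₗ ℕ :=
  toLex (S.path.elapsed (k + 1), S.prio k)

/-- At the moment with key `κ`, the process is in location `γ`, and none of its own events has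
exactly that key. -/
def Script.Occupies {s₀ : Config Q C} (S : A.Script s₀) (γ : Q) (κ : ℝ≥0 ×ₗ ℕ) : Prop :=
  ∃ n, (S.path.conf n).loc = γ ∧ (∀ k < n, S.key k < κ) ∧ κ < S.key n

/-- The steps of `m` processes of a network, without the condition on location guards. -/
def FreeStep (A : GTA Q C) (m : ℕ) (c : Fin m → Config Q C) (δ : ℝ≥0) (a : Fin m × Transition Q C)
    (c' : Fin m → Config Q C) : Prop :=
  (∀ i, A.CanWait (c i) δ) ∧ A.Fires ((c a.1).wait δ) a.2 (c' a.1) ∧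
    ∀ j, j ≠ a.1 → c' j = (c j).wait δ

section Network

variable {m W : ℕ} (ρ : NPath Q C m) (S : Fin W → A.Script A.initConfig) (M : ℕ)

/-- The keys of the given processes (track `none`, with priority `M`) and of the scripts. -/
noncomputable def trackKey : Option (Fin W) → ℕ → ℝ≥0 ×ₗ ℕ
  | none, k => toLex (ρ.elapsed (k + 1), M)
  | some i, k => (S i).key k

/-- The time at which the `k`-th step of a track starts. -/
noncomputable def trackElapsed : Option (Fin W) → ℕ → ℝ≥0
  | none, k => ρ.elapsed k
  | some i, k => (S i).path.elapsed k

theorem trackKey_mono (o : Option (Fin W)) : Monotone (trackKey ρ S M o) := by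
  cases o with
  | none =>
    intro a b hab
    exact Prod.Lex.toLex_mono ⟨ρ.elapsed_mono (Nat.succ_le_succ hab), le_rfl⟩
  | some i => exact (S i).mono

theorem trackKey_fst (o : Option (Fin W)) (k : ℕ) :
    (ofLex (trackKey ρ S M o k)).1 = trackElapsed ρ S o (k + 1) := by
  cases o <;> rfl

theorem trackElapsed_zero (o : Option (Fin W)) : trackElapsed ρ S o 0 = 0 := by
  cases o <;> exact TimedPath.elapsed_zero _

theorem exists_trackKey_lt (n : ℕ) (o : Option (Fin W)) (ho : o ≠ none) :
    ∃ k, trackKey ρ S M none n < trackKey ρ S M o k := by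
  obtain ⟨i, rfl⟩ := Option.ne_none_iff_exists'.1 ho
  obtain ⟨k, hk⟩ := (S i).unbounded (ρ.elapsed (n + 1))
  exact ⟨k, Prod.Lex.toLex_lt_toLex.2 (Or.inl hk)⟩

/-- The number of steps of each track done before step `j` of the merged computation. -/
noncomputable def stepCount (j : ℕ) : Option (Fin W) → ℕ := Merge.count (trackKey ρ S M) j

/-- The time at which step `j` of the merged computation starts. -/
noncomputable def mergeTime (j : ℕ) : ℝ≥0 := Merge.time (trackKey ρ S M) j

/-- The time that track `o` has spent in its current step when step `j` of the merged computation
starts. -/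
noncomputable def waited (j : ℕ) (o : Option (Fin W)) : ℝ≥0 :=
  mergeTime ρ S M j - trackElapsed ρ S o (stepCount ρ S M j o)

/-- The configuration of the given processes before step `j` of the merged computation. -/
noncomputable def mergedMain (j : ℕ) (i : Fin m) : Config Q C :=
  (ρ.conf (stepCount ρ S M j none) i).wait (waited ρ S M j none)

/-- The configuration of the scripted processes before step `j` of the merged computation. -/
noncomputable def mergedScript (j : ℕ) (i : Fin W) : Config Q C :=
  ((S i).path.conf (stepCount ρ S M j (some i))).wait (waited ρ S M j (some i))

/-- The number of steps of the merged computation: it ends with the last step of the given one. -/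
noncomputable def mergedLen : ℕ∞ := ⨆ (j : ℕ) (_ : (stepCount ρ S M j none : ℕ∞) < ρ.len),
  ((j + 1 : ℕ) : ℕ∞)

/-- The action of step `j` of the merged computation. -/
noncomputable def mergedLabel (j : ℕ) : Fin (m + W) × Transition Q C :=
  match Merge.track (trackKey ρ S M) j with
  | none => (Fin.castAdd W (ρ.label (stepCount ρ S M j none)).1,
      (ρ.label (stepCount ρ S M j none)).2)
  | some i => (Fin.natAdd m i, (S i).path.label (stepCount ρ S M j (some i)))

/-- The computation of the network of the given and the scripted processes that executes all events
in the order of their keys. -/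
noncomputable def merged : NPath Q C (m + W) where
  len := mergedLen ρ S M
  conf j := Fin.append (mergedMain ρ S M j) (mergedScript ρ S M j)
  delay j := mergeTime ρ S M (j + 1) - mergeTime ρ S M j
  label := mergedLabel ρ S M

/-- The projection of the merged computation to the given processes; the steps of the scripted
processes become stuttering steps of process `i₀`. -/
noncomputable def mergedProj (i₀ : Fin m) : NPath Q C m where
  len := mergedLen ρ S M
  conf := mergedMain ρ S M
  delay j := mergeTime ρ S M (j + 1) - mergeTime ρ S M j
  label j := match Merge.track (trackKey ρ S M) j with
    | none => ρ.label (stepCount ρ S M j none)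
    | some _ => (i₀, Transition.stutter (mergedMain ρ S M j i₀).loc)

theorem stepCount_mono (o : Option (Fin W)) : Monotone fun j => stepCount ρ S M j o :=
  Merge.count_mono _ o

theorem mergeTime_mono : Monotone (mergeTime ρ S M) := Merge.time_mono (trackKey_mono ρ S M)

theorem elapsed_le_mergeTime (j : ℕ) (o : Option (Fin W)) :
    trackElapsed ρ S o (stepCount ρ S M j o) ≤ mergeTime ρ S M j :=
  Merge.le_time (trackKey_mono ρ S M) (trackElapsed_zero ρ S) (trackKey_fst ρ S M) j o

theorem mergeTime_succ_le (j : ℕ) (o : Option (Fin W)) :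
    mergeTime ρ S M (j + 1) ≤ trackElapsed ρ S o (stepCount ρ S M j o + 1) :=
  Merge.time_succ_le (trackKey_fst ρ S M) j o

theorem mergeTime_succ_eq {j : ℕ} {o : Option (Fin W)} (h : Merge.track (trackKey ρ S M) j = o) :
    mergeTime ρ S M (j + 1) = trackElapsed ρ S o (stepCount ρ S M j o + 1) := by
  subst h
  exact Merge.time_succ_eq (trackKey_fst ρ S M) j

theorem stepCount_succ_self {j : ℕ} {o : Option (Fin W)}
    (h : Merge.track (trackKey ρ S M) j = o) :
    stepCount ρ S M (j + 1) o = stepCount ρ S M j o + 1 := by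
  subst h
  exact Merge.count_succ_self _ j

theorem stepCount_succ_of_ne {j : ℕ} {o : Option (Fin W)}
    (h : Merge.track (trackKey ρ S M) j ≠ o) :
    stepCount ρ S M (j + 1) o = stepCount ρ S M j o :=
  Merge.count_succ_of_ne _ h.symm

theorem trackElapsed_succ_none (k : ℕ) :
    trackElapsed ρ S none (k + 1) = trackElapsed ρ S none k + ρ.delay k :=
  TimedPath.elapsed_succ _ _

theorem trackElapsed_succ_some (i : Fin W) (k : ℕ) :
    trackElapsed ρ S (some i) (k + 1) = trackElapsed ρ S (some i) k + (S i).path.delay k :=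
  TimedPath.elapsed_succ _ _

theorem waited_succ_self {j : ℕ} {o : Option (Fin W)} (h : Merge.track (trackKey ρ S M) j = o) :
    waited ρ S M (j + 1) o = 0 := by
  rw [waited, stepCount_succ_self ρ S M h, mergeTime_succ_eq ρ S M h, tsub_self]

theorem waited_succ_of_ne {j : ℕ} {o : Option (Fin W)} (h : Merge.track (trackKey ρ S M) j ≠ o) :
    waited ρ S M j o + (mergeTime ρ S M (j + 1) - mergeTime ρ S M j) = waited ρ S M (j + 1) o := by
  rw [waited, waited, stepCount_succ_of_ne ρ S M h, add_comm,
    tsub_add_tsub_cancel (mergeTime_mono ρ S M (Nat.le_succ j)) (elapsed_le_mergeTime ρ S M j o)]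

theorem waited_add {j : ℕ} (o : Option (Fin W)) :
    trackElapsed ρ S o (stepCount ρ S M j o) +
      (waited ρ S M j o + (mergeTime ρ S M (j + 1) - mergeTime ρ S M j)) =
      mergeTime ρ S M (j + 1) := by
  rw [waited, ← add_assoc, add_tsub_cancel_of_le (elapsed_le_mergeTime ρ S M j o),
    add_tsub_cancel_of_le (mergeTime_mono ρ S M (Nat.le_succ j))]

theorem waited_add_le_none (j : ℕ) :
    waited ρ S M j none + (mergeTime ρ S M (j + 1) - mergeTime ρ S M j) ≤
      ρ.delay (stepCount ρ S M j none) := by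
  have h := mergeTime_succ_le ρ S M j none
  rw [← waited_add ρ S M none, trackElapsed_succ_none] at h
  exact le_of_add_le_add_left h

theorem waited_add_le_some (j : ℕ) (i : Fin W) :
    waited ρ S M j (some i) + (mergeTime ρ S M (j + 1) - mergeTime ρ S M j) ≤
      (S i).path.delay (stepCount ρ S M j (some i)) := by
  have h := mergeTime_succ_le ρ S M j (some i)
  rw [← waited_add ρ S M (some i), trackElapsed_succ_some] at h
  exact le_of_add_le_add_left h

theorem waited_add_eq_none {j : ℕ} (h : Merge.track (trackKey ρ S M) j = none) :
    waited ρ S M j none + (mergeTime ρ S M (j + 1) - mergeTime ρ S M j) =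
      ρ.delay (stepCount ρ S M j none) := by
  have h := mergeTime_succ_eq ρ S M h
  rw [← waited_add ρ S M none, trackElapsed_succ_none] at h
  exact add_left_cancel h

theorem waited_add_eq_some {j : ℕ} {i : Fin W} (h : Merge.track (trackKey ρ S M) j = some i) :
    waited ρ S M j (some i) + (mergeTime ρ S M (j + 1) - mergeTime ρ S M j) =
      (S i).path.delay (stepCount ρ S M j (some i)) := by
  have h := mergeTime_succ_eq ρ S M h
  rw [← waited_add ρ S M (some i), trackElapsed_succ_some] at h
  exact add_left_cancel h

theorem lt_mergedLen {j : ℕ} :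
    (j : ℕ∞) < mergedLen ρ S M ↔ (stepCount ρ S M j none : ℕ∞) < ρ.len := by
  simp only [mergedLen, lt_iSup_iff, Nat.cast_lt, exists_prop]
  refine ⟨fun ⟨i, hi, hji⟩ => lt_of_le_of_lt ?_ hi, fun h => ⟨j, h, Nat.lt_succ_self j⟩⟩
  exact_mod_cast stepCount_mono ρ S M none (Nat.lt_succ_iff.1 hji)

theorem mergedMain_succ_of_ne {j : ℕ} (h : Merge.track (trackKey ρ S M) j ≠ none) (i : Fin m) :
    mergedMain ρ S M (j + 1) i =
      (mergedMain ρ S M j i).wait (mergeTime ρ S M (j + 1) - mergeTime ρ S M j) := by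
  rw [mergedMain, mergedMain, Config.wait_wait, waited_succ_of_ne ρ S M h,
    stepCount_succ_of_ne ρ S M h]

theorem mergedScript_succ_of_ne {j : ℕ} {i : Fin W}
    (h : Merge.track (trackKey ρ S M) j ≠ some i) :
    mergedScript ρ S M (j + 1) i =
      (mergedScript ρ S M j i).wait (mergeTime ρ S M (j + 1) - mergeTime ρ S M j) := by
  rw [mergedScript, mergedScript, Config.wait_wait, waited_succ_of_ne ρ S M h,
    stepCount_succ_of_ne ρ S M h]

theorem mergedMain_succ_self {j : ℕ} (h : Merge.track (trackKey ρ S M) j = none) (i : Fin m) :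
    mergedMain ρ S M (j + 1) i = ρ.conf (stepCount ρ S M j none + 1) i := by
  rw [mergedMain, waited_succ_self ρ S M h, Config.wait_zero, stepCount_succ_self ρ S M h]

theorem mergedScript_succ_self {j : ℕ} {i : Fin W}
    (h : Merge.track (trackKey ρ S M) j = some i) :
    mergedScript ρ S M (j + 1) i = (S i).path.conf (stepCount ρ S M j (some i) + 1) := by
  rw [mergedScript, waited_succ_self ρ S M h, Config.wait_zero, stepCount_succ_self ρ S M h]

theorem mergedScript_loc {j : ℕ} {i : Fin W} {γ : Q}
    (h : (S i).Occupies γ (Merge.key (trackKey ρ S M) j)) : (mergedScript ρ S M j i).loc = γ := by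
  obtain ⟨n, hn, h₁, h₂⟩ := h
  have : stepCount ρ S M j (some i) = n := Merge.count_eq (trackKey_mono ρ S M) h₁ h₂
  rw [← hn, ← this]
  rfl

/-- A script has no event at a key at which it occupies a location. -/
theorem Script.not_occupies_key {s₀ : Config Q C} (S : A.Script s₀) (γ : Q) (n : ℕ) :
    ¬ S.Occupies γ (S.key n) := by
  rintro ⟨k, -, h₁, h₂⟩
  rcases lt_or_ge n k with hnk | hnk
  · exact (h₁ n hnk).ne rfl
  · exact (S.mono hnk).not_gt h₂

theorem merged_nStep (hρ : ρ.Follows (A.FreeStep m))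
    (hguard : ∀ k : ℕ, (k : ℕ∞) < ρ.len → ∀ γ, (ρ.label k).2.locGuard = some γ →
      ∃ i, (S i).Occupies γ (toLex (ρ.elapsed (k + 1), M)))
    (hscript : ∀ i n γ, ((S i).path.label n).locGuard = some γ →
      ∃ i', (S i').Occupies γ ((S i).key n)) :
    (merged ρ S M).Follows (A.NStep (m + W)) := by
  intro j hj
  have hlen := (lt_mergedLen ρ S M).1 hj
  obtain ⟨hwait, hfire, hrest⟩ := hρ _ hlen
  have hloc : ∀ i γ, (S i).Occupies γ (Merge.key (trackKey ρ S M) j) →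
      ((merged ρ S M).conf j (Fin.natAdd m i)).loc = γ := by
    intro i γ h
    simpa [merged] using mergedScript_loc ρ S M h
  refine ⟨?_, ?_⟩
  · refine Fin.addCases (fun i => ?_) fun i => ?_
    · simp only [merged, Fin.append_left]
      exact (hwait i).of_add (waited_add_le_none ρ S M j)
    · simp only [merged, Fin.append_right]
      exact ((S i).step _).1.of_add (waited_add_le_some ρ S M j i)
  · cases htr : Merge.track (trackKey ρ S M) j with
    | none =>
      have hkey : Merge.key (trackKey ρ S M) j =
          toLex (ρ.elapsed (stepCount ρ S M j none + 1), M) := by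
        rw [Merge.key, htr]
        rfl
      have hlab : (merged ρ S M).label j =
          (Fin.castAdd W (ρ.label (stepCount ρ S M j none)).1,
            (ρ.label (stepCount ρ S M j none)).2) := by
        simp only [merged, mergedLabel, htr]
      rw [hlab]
      refine ⟨?_, fun γ hγ => ?_, ?_⟩
      · simp only [merged, Fin.append_left]
        rw [mergedMain, Config.wait_wait, waited_add_eq_none ρ S M htr,
          mergedMain_succ_self ρ S M htr]
        exact hfire
      · obtain ⟨i, hi⟩ := hguard _ hlen γ hγ
        rw [← hkey] at hi
        exact ⟨Fin.natAdd m i, by simp [Fin.ext_iff]; omega, hloc i γ hi⟩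
      · refine Fin.addCases (fun i hi => ?_) fun i _ => ?_
        · simp only [merged, Fin.append_left]
          rw [mergedMain, mergedMain, Config.wait_wait, waited_succ_self ρ S M htr,
            waited_add_eq_none ρ S M htr, stepCount_succ_self ρ S M htr, Config.wait_zero]
          exact hrest i fun h => hi (by rw [h])
        · simp only [merged, Fin.append_right]
          exact mergedScript_succ_of_ne ρ S M (by simp [htr])
    | some p =>
      have hkey : Merge.key (trackKey ρ S M) j = (S p).key (stepCount ρ S M j (some p)) := by
        rw [Merge.key, htr]
        rfl
      have hlab : (merged ρ S M).label j =
          (Fin.natAdd m p, (S p).path.label (stepCount ρ S M j (some p))) := by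
        simp only [merged, mergedLabel, htr]
      rw [hlab]
      refine ⟨?_, fun γ hγ => ?_, ?_⟩
      · simp only [merged, Fin.append_right]
        rw [mergedScript, Config.wait_wait, waited_add_eq_some ρ S M htr,
          mergedScript_succ_self ρ S M htr]
        exact ((S p).step _).2
      · obtain ⟨i, hi⟩ := hscript _ _ γ hγ
        have hip : i ≠ p := by
          rintro rfl
          exact (S i).not_occupies_key γ _ hi
        rw [← hkey] at hi
        exact ⟨Fin.natAdd m i, by simpa using hip, hloc i γ hi⟩
      · refine Fin.addCases (fun i _ => ?_) fun i hi => ?_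
        · simp only [merged, Fin.append_left]
          exact mergedMain_succ_of_ne ρ S M (by simp [htr]) i
        · simp only [merged, Fin.append_right]
          refine mergedScript_succ_of_ne ρ S M ?_
          rw [htr]
          rintro ⟨⟩
          exact hi rfl

theorem merged_conf_zero (h0 : ρ.conf 0 = fun _ => A.initConfig) :
    (merged ρ S M).conf 0 = fun _ => A.initConfig := by
  have hw : ∀ o, waited ρ S M 0 o = 0 := fun o => by
    simp [waited, mergeTime, Merge.time]
  funext i
  refine Fin.addCases (fun i => ?_) (fun i => ?_) i
  · simp [merged, mergedMain, hw, Config.wait_zero, stepCount, Merge.count, h0]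
  · simp [merged, mergedScript, hw, Config.wait_zero, stepCount, Merge.count, (S i).start]

theorem isProjection_merged (i₀ : Fin m) :
    IsProjection (Nat.le_add_right m W) (merged ρ S M) (mergedProj ρ S M i₀) := by
  refine ⟨rfl, fun k _ i => ?_, fun k _ => ⟨rfl, ?_⟩⟩
  · exact (Fin.append_left (mergedMain ρ S M k) (mergedScript ρ S M k) i).symm
  · cases htr : Merge.track (trackKey ρ S M) k with
    | none =>
      left
      simp [mergedProj, merged, mergedLabel, htr]
      rfl
    | some p =>
      right
      simp only [mergedProj, merged, mergedLabel, htr]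
      refine ⟨fun i h => ?_, trivial⟩
      have := congrArg Fin.val h
      simp at this
      omega

theorem elapsed_mergedProj (i₀ : Fin m) (j : ℕ) :
    (mergedProj ρ S M i₀).elapsed j = mergeTime ρ S M j := by
  induction j with
  | zero => rw [TimedPath.elapsed_zero]; rfl
  | succ j ih =>
    rw [TimedPath.elapsed_succ, ih]
    exact add_tsub_cancel_of_le (mergeTime_mono ρ S M (Nat.le_succ j))

theorem isStutterExpansion_mergedProj (i₀ : Fin m) :
    ρ.IsStutterExpansion (fun a => a.2.IsStutter) (mergedProj ρ S M i₀) := by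
  choose f hf using Merge.exists_track_eq (trackKey_mono ρ S M) (exists_trackKey_lt ρ S M)
  have hcount : ∀ k, stepCount ρ S M (f k) none = k := fun k => (hf k).2
  have hsucc : ∀ k, stepCount ρ S M (f k + 1) none = k + 1 := fun k => by
    rw [stepCount_succ_self ρ S M (hf k).1, hcount]
  refine ⟨?_, f, strictMono_nat_of_lt_succ fun k => ?_, fun k hk => ⟨?_, ?_, ?_, ?_⟩,
    fun j hj => ⟨⟨stepCount ρ S M j none, (lt_mergedLen ρ S M).1 hj, ?_⟩, fun hne => ?_⟩⟩
  · funext i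
    simp [mergedProj, mergedMain, waited, mergeTime, Merge.time, stepCount, Merge.count,
      Config.wait_zero]
  · by_contra! h
    have := stepCount_mono ρ S M none h
    simp only [hcount] at this
    omega
  · rw [mergedProj, lt_mergedLen, hcount]
    exact hk
  · simp only [mergedProj, (hf k).1, hcount]
  · rw [elapsed_mergedProj, mergeTime_succ_eq ρ S M (hf k).1, hcount]
    rfl
  · funext i
    have := mergedMain_succ_self ρ S M (hf k).1 i
    rwa [hcount] at this
  · by_contra! h
    have := stepCount_mono ρ S M none (Nat.succ_le_of_lt h)
    simp only [hsucc] at this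
    omega
  · cases htr : Merge.track (trackKey ρ S M) j with
    | none =>
      exfalso
      refine hne _ ((lt_mergedLen ρ S M).1 hj) ?_
      by_contra hjf
      rcases lt_or_gt_of_ne hjf with h | h
      · have := stepCount_mono ρ S M none (Nat.succ_le_of_lt h)
        simp only [hsucc] at this
        omega
      · have := stepCount_mono ρ S M none (Nat.succ_le_of_lt h)
        simp only [hcount, Nat.succ_eq_add_one, stepCount_succ_self ρ S M htr] at this
        omega
    | some p =>
      simp only [mergedProj, htr]
      exact ⟨_, rfl⟩

/-- If the scripted processes occupy every location guard at the moment when it is needed, then the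
given run of `m` processes can be executed next to them. -/
theorem mem_projLanguage_of_scripts (hm : 0 < m) (h0 : ρ.conf 0 = fun _ => A.initConfig)
    (hρ : ρ.Follows (A.FreeStep m))
    (hguard : ∀ k : ℕ, (k : ℕ∞) < ρ.len → ∀ γ, (ρ.label k).2.locGuard = some γ →
      ∃ i, (S i).Occupies γ (toLex (ρ.elapsed (k + 1), M)))
    (hscript : ∀ i n γ, ((S i).path.label n).locGuard = some γ →
      ∃ i', (S i').Occupies γ ((S i).key n)) :
    ρ ∈ A.projLanguage m (m + W) :=
  ⟨Nat.le_add_right m W, merged ρ S M,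
    ⟨merged_conf_zero ρ S M h0, merged_nStep ρ S M hρ hguard hscript⟩,
    mergedProj ρ S M ⟨0, hm⟩, isProjection_merged ρ S M _, isStutterExpansion_mergedProj ρ S M _⟩

end Network

end GTA

/-! ### Runs of the summary automaton -/

namespace ClockConstraint

variable {C D : Type*}

theorem sat_map {f : C → D} {φ : ClockConstraint C} {v : D → ℝ≥0} :
    (φ.map f).Sat v ↔ φ.Sat fun c => v (f c) := by
  induction φ with
  | top => rfl
  | and φ χ h₁ h₂ => exact and_congr h₁ h₂
  | diff => rfl
  | bound => rfl

/-- With a single clock, the values that satisfy a constraint form an interval. -/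
theorem sat_of_mem_Icc {φ : ClockConstraint C} {a b x : ℝ≥0} (ha : φ.Sat fun _ => a)
    (hb : φ.Sat fun _ => b) (hax : a ≤ x) (hxb : x ≤ b) : φ.Sat fun _ => x := by
  induction φ with
  | top => trivial
  | and φ χ h₁ h₂ => exact ⟨h₁ ha.1 hb.1, h₂ ha.2 hb.2⟩
  | diff c r c' d =>
    cases r <;> simp_all [Sat, ClockRel.Holds]
  | bound c r d =>
    cases r <;> simp only [Sat, ClockRel.Holds] at ha hb ⊢
    · exact hxb.trans_lt hb
    · exact hxb.trans hb
    · exact le_antisymm (hxb.trans hb.le) (ha.ge.trans hax)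
    · exact ha.trans hax
    · exact ha.trans_le hax

end ClockConstraint

/-- The configuration of `A` underlying a configuration of the summary automaton. -/
def Config.forgetTime {Q C : Type*} (s : Config Q (Option C)) : Config Q C :=
  ⟨s.loc, fun c => s.val (some c)⟩

namespace GTA

variable {Q C : Type*} {A : GTA Q C}

theorem SummaryStep.step {s s' : Config Q (Option C)} {δ : ℝ≥0} {τ : Transition Q C}
    (h : A.SummaryStep s δ τ s') : A.Step s.forgetTime δ τ s'.forgetTime := by
  obtain ⟨⟨hτ, -⟩, hwait, -, hsrc, hguard, htgt, hval, hinv⟩ := h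
  refine ⟨fun δ' hδ' => (ClockConstraint.sat_map (f := some)).1 (hwait δ' hδ'), Or.inl hτ, hsrc, ?_, htgt,
    fun c => ?_, (ClockConstraint.sat_map (f := some)).1 hinv⟩
  · have hg : (τ.guard.map some).Sat (s.wait δ).val := by
      unfold summaryTrans at hguard
      cases hγ : τ.locGuard with
      | none => simpa [hγ] using hguard
      | some γ =>
        simp only [hγ] at hguard
        exact hguard.1
    exact (ClockConstraint.sat_map (f := some)).1 hg
  · have := hval (some c)
    refine this.trans ?_
    by_cases hc : c ∈ τ.reset
    · rw [if_pos hc, if_pos (by simpa [summaryTrans] using hc)]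
    · rw [if_neg hc, if_neg (by simpa [summaryTrans] using hc)]
      rfl

theorem SummaryStep.val_none {s s' : Config Q (Option C)} {δ : ℝ≥0} {τ : Transition Q C}
    (h : A.SummaryStep s δ τ s') : s'.val none = s.val none + δ := by
  obtain ⟨-, -, -, -, -, -, hval, -⟩ := h
  simpa [summaryTrans, Config.wait] using hval none

theorem SummaryStep.locGuard {s s' : Config Q (Option C)} {δ : ℝ≥0} {τ : Transition Q C}
    (h : A.SummaryStep s δ τ s') {γ : Q} (hγ : τ.locGuard = some γ) :
    γ ∈ A.rGuards ∧ A.minReach γ ≤ s.val none + δ := by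
  obtain ⟨⟨hτ, hreach⟩, -, -, -, hguard, -⟩ := h
  refine ⟨⟨⟨τ, hτ, hγ⟩, hreach γ hγ⟩, ?_⟩
  simp only [summaryTrans, hγ] at hguard
  exact hguard.2

theorem val_none_eq_elapsed {ρ : SummaryPath Q C} (hρ : ρ.Follows A.SummaryStep) {k : ℕ}
    (hk : (k : ℕ∞) ≤ ρ.len) : (ρ.conf k).val none = (ρ.conf 0).val none + ρ.elapsed k := by
  induction k with
  | zero => simp [TimedPath.elapsed_zero]
  | succ k ih =>
    have hlt : (k : ℕ∞) < ρ.len := lt_of_lt_of_le (by exact_mod_cast Nat.lt_succ_self k) hk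
    rw [(hρ k hlt).val_none, ih hlt.le, TimedPath.elapsed_succ, add_assoc]

/-! ### A stem followed by an infinite script -/

theorem toLex_add_lt {a b d : ℝ≥0} {p r : ℕ} (h : (toLex (a, p) : ℝ≥0 ×ₗ ℕ) < toLex (b, r)) :
    (toLex (d + a, p) : ℝ≥0 ×ₗ ℕ) < toLex (d + b, r) := by
  simpa [Prod.Lex.toLex_lt_toLex] using h

theorem toLex_add_le {a b d : ℝ≥0} {p r : ℕ} (h : (toLex (a, p) : ℝ≥0 ×ₗ ℕ) ≤ toLex (b, r)) :
    (toLex (d + a, p) : ℝ≥0 ×ₗ ℕ) ≤ toLex (d + b, r) := by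
  simpa [Prod.Lex.toLex_le_toLex] using h

/-- Every location guard used by a script that starts at time `t₀` is a reachable one, is used no
earlier than its minimal reachability time, and is used with a priority above its rank. -/
def Script.GuardsReady {s₀ : Config Q C} (S : A.Script s₀) (ord : Q → ℕ) (t₀ : ℝ≥0) : Prop :=
  ∀ k γ, (S.path.label k).locGuard = some γ →
    γ ∈ A.rGuards ∧ A.minReach γ ≤ t₀ + S.path.elapsed (k + 1) ∧ ord γ < S.prio k

section Append

variable {L S : Type*}

/-- The first `n` steps of `ρ`, followed by the steps of `σ`. -/
def appendPath (ρ σ : TimedPath S L) (n : ℕ) : TimedPath S L where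
  len := n + σ.len
  conf k := if k < n then ρ.conf k else σ.conf (k - n)
  delay k := if k < n then ρ.delay k else σ.delay (k - n)
  label k := if k < n then ρ.label k else σ.label (k - n)

theorem elapsed_appendPath_of_le (ρ σ : TimedPath S L) {n k : ℕ} (h : k ≤ n) :
    (appendPath ρ σ n).elapsed k = ρ.elapsed k := by
  refine Finset.sum_congr rfl fun i hi => ?_
  exact if_pos ((Finset.mem_range.1 hi).trans_le h)

theorem elapsed_appendPath_add (ρ σ : TimedPath S L) (n k : ℕ) :
    (appendPath ρ σ n).elapsed (n + k) = ρ.elapsed n + σ.elapsed k := by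
  induction k with
  | zero => rw [TimedPath.elapsed_zero, add_zero, add_zero, elapsed_appendPath_of_le _ _ le_rfl]
  | succ k ih =>
    rw [← add_assoc, TimedPath.elapsed_succ, TimedPath.elapsed_succ, ih, add_assoc]
    simp [appendPath]

end Append

/-- A run that reaches `q` at its minimal reachability time, executed with the rank of `q` as
priority and followed by an infinite script. -/
theorem IsMinimalRun.exists_script {ord : Q → ℕ} {q : Q} {ρ : SummaryPath Q C} {n : ℕ}
    (hρ : A.IsMinimalRun ord q ρ n) (σ : A.Script (ρ.conf n).forgetTime)
    (hkey : toLex (0, ord q) ≤ σ.key 0) (hσ : σ.GuardsReady ord (A.minReach q)) :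
    ∃ S : A.Script A.initConfig, S.GuardsReady ord 0 ∧
      ∀ γ t p, ord q < p → σ.Occupies γ (toLex (t, p)) →
        S.Occupies γ (toLex (A.minReach q + t, p)) := by
  obtain ⟨hlen, h0, hfol, hloc, hmin, hord⟩ := hρ
  have hstep : ∀ k < n, A.SummaryStep (ρ.conf k) (ρ.delay k) (ρ.label k) (ρ.conf (k + 1)) :=
    fun k hk => hfol k (by rw [hlen]; exact_mod_cast hk)
  let ρ' : TimedPath (Config Q C) (Transition Q C) :=
    ⟨ρ.len, fun k => (ρ.conf k).forgetTime, ρ.delay, ρ.label⟩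
  let P := appendPath ρ' σ.path n
  let prio : ℕ → ℕ := fun k => if k < n then ord q else σ.prio (k - n)
  have hel : ∀ k, k ≤ n → P.elapsed k = ρ.elapsed k := fun k hk =>
    elapsed_appendPath_of_le ρ' σ.path hk
  have hadd : ∀ k, P.elapsed (n + k) = A.minReach q + σ.path.elapsed k := fun k =>
    (elapsed_appendPath_add ρ' σ.path n k).trans (by rw [← hmin]; rfl)
  have hconf : P.conf n = (ρ.conf n).forgetTime := by
    simp [P, appendPath, σ.start]
  have hconf' : ∀ k ≤ n, P.conf k = (ρ.conf k).forgetTime := fun k hk => by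
    rcases hk.lt_or_eq with h | rfl
    · exact if_pos h
    · exact hconf
  have hkey_lt : ∀ k < n, (toLex (P.elapsed (k + 1), prio k) : ℝ≥0 ×ₗ ℕ) =
      toLex (ρ.elapsed (k + 1), ord q) := fun k hk => by
    rw [hel _ hk]
    simp [prio, hk]
  have hkey_add : ∀ k, (toLex (P.elapsed (n + k + 1), prio (n + k)) : ℝ≥0 ×ₗ ℕ) =
      toLex (A.minReach q + σ.path.elapsed (k + 1), σ.prio k) := fun k => by
    rw [add_assoc, hadd]
    simp [prio]
  let S : A.Script A.initConfig :=
    { path := P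
      prio := prio
      start := by
        rw [hconf' 0 (Nat.zero_le n), h0]
        rfl
      step := fun k => by
        rcases lt_or_ge k n with h | h
        · rw [hconf' k h.le, hconf' (k + 1) h]
          simpa [P, appendPath, h, ρ'] using (hstep k h).step
        · obtain ⟨k, rfl⟩ := Nat.exists_eq_add_of_le h
          simpa [P, appendPath, add_assoc] using σ.step k
      mono := by
        refine monotone_nat_of_le_succ fun k => ?_
        rcases lt_or_ge (k + 1) n with h | h
        · rw [hkey_lt k (by omega), hkey_lt _ h]
          exact Prod.Lex.toLex_mono ⟨ρ.elapsed_mono (Nat.le_succ _), le_rfl⟩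
        · rcases h.eq_or_lt with h | h
          · have h2 := hkey_add 0
            simp only [add_zero] at h2
            have h3 : (toLex (P.elapsed (k + 1), prio k) : ℝ≥0 ×ₗ ℕ) =
                toLex (A.minReach q + 0, ord q) := by
              rw [hkey_lt k (by omega), ← h, hmin, add_zero]
            rw [h3, ← h, h2]
            exact toLex_add_le hkey
          · obtain ⟨k, rfl⟩ := Nat.exists_eq_add_of_le (Nat.lt_succ_iff.1 h)
            rw [hkey_add, add_assoc n k 1, hkey_add]
            exact toLex_add_le (σ.mono (Nat.le_succ k))
      unbounded := fun t => by
        obtain ⟨k, hk⟩ := σ.unbounded t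
        exact ⟨n + k, by rw [add_assoc, hadd]; exact hk.trans_le le_add_self⟩ }
  refine ⟨S, fun k γ hγ => ?_, fun γ t p hp => ?_⟩
  · rw [zero_add]
    change (P.label k).locGuard = some γ at hγ
    change γ ∈ A.rGuards ∧ A.minReach γ ≤ P.elapsed (k + 1) ∧ ord γ < prio k
    rcases lt_or_ge k n with h | h
    · have hγ' : (ρ.label k).locGuard = some γ := by
        simpa [P, appendPath, h, ρ'] using hγ
      obtain ⟨h1, h2⟩ := (hstep k h).locGuard hγ'
      refine ⟨h1, ?_, ?_⟩
      · rw [hel _ h, TimedPath.elapsed_succ]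
        have hk : (ρ.conf k).val none = (ρ.conf 0).val none + ρ.elapsed k :=
          val_none_eq_elapsed hfol (by rw [hlen]; exact_mod_cast h.le)
        have h00 : (ρ.conf 0).val none = 0 := by rw [h0]; rfl
        rwa [hk, h00, zero_add] at h2
      · simpa [prio, h] using hord k h γ hγ'
    · obtain ⟨k, rfl⟩ := Nat.exists_eq_add_of_le h
      have := hσ k γ (by simpa [P, appendPath] using hγ)
      rw [add_assoc, hadd]
      simpa [prio] using this
  · rintro ⟨k, hk, h₁, h₂⟩
    refine ⟨n + k, ?_, fun i hi => ?_, ?_⟩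
    · simpa [S, P, appendPath] using hk
    · change (toLex (P.elapsed (i + 1), prio i) : ℝ≥0 ×ₗ ℕ) < _
      rcases lt_or_ge i n with h | h
      · rw [hkey_lt i h]
        have : ρ.elapsed (i + 1) ≤ A.minReach q + t :=
          ((ρ.elapsed_mono h).trans_eq hmin).trans le_self_add
        rcases this.lt_or_eq with h3 | h3
        · exact Prod.Lex.toLex_lt_toLex.2 (Or.inl h3)
        · exact Prod.Lex.toLex_lt_toLex.2 (Or.inr ⟨h3, hp⟩)
      · obtain ⟨i, rfl⟩ := Nat.exists_eq_add_of_le h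
        rw [hkey_add]
        exact toLex_add_lt (h₁ i (by omega))
    · change _ < (toLex (P.elapsed (n + k + 1), prio (n + k)) : ℝ≥0 ×ₗ ℕ)
      rw [hkey_add]
      exact toLex_add_lt h₂

/-! ### Flooding a location without invariant -/

/-- Stuttering once per time unit. -/
theorem exists_idle_script (s : Config Q C) (hs : A.inv s.loc = .top) :
    ∃ S : A.Script s, S.key 0 = toLex (1, 0) ∧ (∀ ord t, S.GuardsReady ord t) ∧
      ∀ t p, 0 < p → S.Occupies s.loc (toLex (t, p)) := by
  let P : TimedPath (Config Q C) (Transition Q C) :=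
    ⟨⊤, fun k => s.wait k, fun _ => 1, fun _ => Transition.stutter s.loc⟩
  have hel : ∀ k, P.elapsed k = k := fun k => by simp [TimedPath.elapsed, P]
  let S : A.Script s :=
    { path := P
      prio := fun _ => 0
      start := by simp [P, Config.wait_zero]
      step := fun k => by
        have hw : s.wait ((k + 1 : ℕ) : ℝ≥0) = (s.wait k).wait 1 := by
          rw [Config.wait_wait, Nat.cast_succ]
        have hinv : ∀ v, (A.inv s.loc).Sat v := fun v => by rw [hs]; trivial
        refine ⟨fun δ _ => hinv _, ?_⟩
        simp only [P, hw]
        exact fires_stutter (hinv _)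
      mono := fun a b hab => Prod.Lex.toLex_mono ⟨P.elapsed_mono (Nat.succ_le_succ hab), le_rfl⟩
      unbounded := fun t => by
        obtain ⟨k, hk⟩ := exists_nat_gt t
        exact ⟨k, by rw [hel]; exact hk.trans (by exact_mod_cast Nat.lt_succ_self k)⟩ }
  have hkey : ∀ k, S.key k = toLex (((k + 1 : ℕ) : ℝ≥0), 0) := fun k => by
    rw [← hel]
    rfl
  refine ⟨S, by simpa using hkey 0, fun ord t k γ hγ => ?_, fun t p hp => ?_⟩
  · change none = some γ at hγ
    cases hγ
  refine ⟨⌊t⌋₊, rfl, fun k hk => ?_, ?_⟩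
  · rw [hkey]
    have : ((k + 1 : ℕ) : ℝ≥0) ≤ t := (Nat.cast_le.2 hk).trans (Nat.floor_le zero_le)
    rcases this.lt_or_eq with h | h
    · exact Prod.Lex.toLex_lt_toLex.2 (Or.inl h)
    · exact Prod.Lex.toLex_lt_toLex.2 (Or.inr ⟨h, hp⟩)
  · rw [hkey]
    exact Prod.Lex.toLex_lt_toLex.2 (Or.inl (by exact_mod_cast Nat.lt_floor_add_one t))

theorem IsMinimalRun.exists_flooding_script {ord : Q → ℕ} {q : Q} {ρ : SummaryPath Q C} {n : ℕ}
    (hρ : A.IsMinimalRun ord q ρ n) (hq : A.inv q = .top) :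
    ∃ S : A.Script A.initConfig, S.GuardsReady ord 0 ∧
      ∀ t p, A.minReach q ≤ t → ord q < p → S.Occupies q (toLex (t, p)) := by
  have hloc : (ρ.conf n).forgetTime.loc = q := hρ.2.2.2.1
  obtain ⟨σ, h0, hg, ho⟩ := exists_idle_script (A := A) (ρ.conf n).forgetTime (by rw [hloc, hq])
  obtain ⟨S, hS, hocc⟩ := hρ.exists_script σ
    (by rw [h0]; exact Prod.Lex.toLex_le_toLex.2 (Or.inl one_pos)) (hg _ _)
  refine ⟨S, hS, fun t p ht hp => ?_⟩
  obtain ⟨u, rfl⟩ := exists_add_of_le ht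
  have := ho u p (by omega)
  rw [hloc] at this
  exact hocc _ _ _ hp this

/-! ### Scripts that consist of laps of equal length -/

section Laps

theorem succ_div_mod {l : ℕ} (hl : 0 < l) (N : ℕ) :
    (N % l + 1 < l ∧ (N + 1) / l = N / l ∧ (N + 1) % l = N % l + 1) ∨
      (N % l + 1 = l ∧ (N + 1) / l = N / l + 1 ∧ (N + 1) % l = 0) := by
  have h1 : N + 1 = l * (N / l) + (N % l + 1) := by rw [← add_assoc, Nat.div_add_mod]
  rcases (Nat.succ_le_of_lt (Nat.mod_lt N hl)).lt_or_eq with h | h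
  · refine Or.inl ⟨h, ?_, ?_⟩
    · rw [h1, Nat.mul_add_div hl, Nat.div_eq_of_lt h, add_zero]
    · rw [h1, Nat.mul_add_mod, Nat.mod_eq_of_lt h]
  · refine Or.inr ⟨h, ?_, ?_⟩
    · rw [h1, Nat.mul_add_div hl]
      exact congrArg _ (by rw [show N % l + 1 = l from h, Nat.div_self hl])
    · rw [h1, Nat.mul_add_mod, show N % l + 1 = l from h, Nat.mod_self]

/-- Laps of `l` steps each: lap `j` visits `conf j 0, …, conf j l`, its `p`-th step has priority
`prio j p`, and `clock j p` is the time after the first `p` steps of lap `j`. -/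
structure Laps (A : GTA Q C) (s₀ : Config Q C) where
  l : ℕ
  pos : 0 < l
  conf : ℕ → ℕ → Config Q C
  delay : ℕ → ℕ → ℝ≥0
  label : ℕ → ℕ → Transition Q C
  prio : ℕ → ℕ → ℕ
  clock : ℕ → ℕ → ℝ≥0
  start : conf 0 0 = s₀
  step : ∀ j p, p < l → A.Step (conf j p) (delay j p) (label j p) (conf j (p + 1))
  conf_end : ∀ j, conf j l = conf (j + 1) 0
  clock_zero : clock 0 0 = 0
  clock_succ : ∀ j p, p < l → clock j (p + 1) = clock j p + delay j p
  clock_end : ∀ j, clock j l = clock (j + 1) 0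
  key_le_succ : ∀ j p, p + 1 < l →
    (toLex (clock j (p + 1), prio j p) : ℝ≥0 ×ₗ ℕ) ≤ toLex (clock j (p + 1 + 1), prio j (p + 1))
  key_le_next : ∀ j,
    (toLex (clock j l, prio j (l - 1)) : ℝ≥0 ×ₗ ℕ) ≤ toLex (clock (j + 1) 1, prio (j + 1) 0)
  unbounded : ∀ t, ∃ j, t < clock j 1

namespace Laps

variable {s₀ : Config Q C} (Λ : A.Laps s₀)

/-- The concatenation of all laps. -/
noncomputable def path : TimedPath (Config Q C) (Transition Q C) where
  len := ⊤
  conf N := Λ.conf (N / Λ.l) (N % Λ.l)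
  delay N := Λ.delay (N / Λ.l) (N % Λ.l)
  label N := Λ.label (N / Λ.l) (N % Λ.l)

theorem elapsed_path (N : ℕ) : Λ.path.elapsed N = Λ.clock (N / Λ.l) (N % Λ.l) := by
  induction N with
  | zero => simp [TimedPath.elapsed_zero, Λ.clock_zero]
  | succ N ih =>
    rw [TimedPath.elapsed_succ, ih]
    have h := Λ.clock_succ (N / Λ.l) (N % Λ.l) (Nat.mod_lt N Λ.pos)
    rcases succ_div_mod Λ.pos N with ⟨-, h2, h3⟩ | ⟨h1, h2, h3⟩
    · rw [h2, h3, h]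
      rfl
    · rw [h2, h3, ← Λ.clock_end]
      rw [h1] at h
      rw [h]
      rfl

theorem elapsed_path_succ (N : ℕ) :
    Λ.path.elapsed (N + 1) = Λ.clock (N / Λ.l) (N % Λ.l + 1) := by
  rw [TimedPath.elapsed_succ, elapsed_path, Λ.clock_succ _ _ (Nat.mod_lt N Λ.pos)]
  rfl

/-- The script that executes the laps one after the other. -/
noncomputable def script : A.Script s₀ where
  path := Λ.path
  prio N := Λ.prio (N / Λ.l) (N % Λ.l)
  start := by simp [path, Λ.start]
  step N := by
    have h := Λ.step (N / Λ.l) (N % Λ.l) (Nat.mod_lt N Λ.pos)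
    have hc : Λ.path.conf (N + 1) = Λ.conf (N / Λ.l) (N % Λ.l + 1) := by
      rcases succ_div_mod Λ.pos N with ⟨-, h2, h3⟩ | ⟨h1, h2, h3⟩
      · simp only [path, h2, h3]
      · simp only [path, h2, h3, h1, Λ.conf_end]
    rw [hc]
    exact h
  mono := by
    refine monotone_nat_of_le_succ fun N => ?_
    rw [elapsed_path_succ, elapsed_path_succ]
    rcases succ_div_mod Λ.pos N with ⟨h1, h2, h3⟩ | ⟨h1, h2, h3⟩
    · rw [h2, h3]
      exact Λ.key_le_succ _ _ h1
    · rw [h2, h3, h1, show N % Λ.l = Λ.l - 1 by omega]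
      exact Λ.key_le_next _
  unbounded t := by
    obtain ⟨j, hj⟩ := Λ.unbounded t
    refine ⟨j * Λ.l, ?_⟩
    rwa [elapsed_path_succ, Nat.mul_div_cancel _ Λ.pos, Nat.mul_mod_left]

theorem key_script (N : ℕ) : Λ.script.key N =
    toLex (Λ.clock (N / Λ.l) (N % Λ.l + 1), Λ.prio (N / Λ.l) (N % Λ.l)) := by
  rw [← elapsed_path_succ]
  rfl

theorem occupies_first {κ : ℝ≥0 ×ₗ ℕ} (h : κ < toLex (Λ.clock 0 1, Λ.prio 0 0)) :
    Λ.script.Occupies s₀.loc κ := by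
  refine ⟨0, congrArg Config.loc Λ.script.start, by simp, ?_⟩
  rw [key_script]
  simpa using h

theorem occupies_next {κ : ℝ≥0 ×ₗ ℕ} (j : ℕ)
    (h₁ : toLex (Λ.clock j Λ.l, Λ.prio j (Λ.l - 1)) < κ)
    (h₂ : κ < toLex (Λ.clock (j + 1) 1, Λ.prio (j + 1) 0)) :
    Λ.script.Occupies (Λ.conf (j + 1) 0).loc κ := by
  have hl := Λ.pos
  refine ⟨(j + 1) * Λ.l, ?_, fun k hk => ?_, ?_⟩
  · simp [script, path, Nat.mul_div_cancel _ hl]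
  · refine lt_of_le_of_lt (Λ.script.mono (show k ≤ j * Λ.l + (Λ.l - 1) from ?_)) ?_
    · rw [add_mul, one_mul] at hk
      omega
    · refine lt_of_eq_of_lt ?_ h₁
      have h1 : (j * Λ.l + (Λ.l - 1)) / Λ.l = j := by
        rw [mul_comm, Nat.mul_add_div hl, Nat.div_eq_of_lt (by omega), add_zero]
      have h2 : (j * Λ.l + (Λ.l - 1)) % Λ.l = Λ.l - 1 := by
        rw [mul_comm, Nat.mul_add_mod, Nat.mod_eq_of_lt (by omega)]
      have := key_script Λ (j * Λ.l + (Λ.l - 1))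
      rw [h1, h2, Nat.sub_add_cancel hl] at this
      exact this
  · rw [key_script, Nat.mul_div_cancel _ hl, Nat.mul_mod_left]
    exact h₂

end Laps

end Laps

end GTA

/-! ### Running through the loop of a flooding lasso -/

namespace GTA.FloodingLasso

variable {Q C : Type*} [Unique C] {A : GTA Q C} {ord : Q → ℕ} {q : Q} (L : A.FloodingLasso ord q)

/-- The clock value at the end of the stem. -/
noncomputable def v₀ : ℝ≥0 := (L.stem.conf L.n).val (some default)

/-- The time that passes in the loop after the first reset and before step `p`. -/
noncomputable def off (p : ℕ) : ℝ≥0 := ∑ k ∈ Finset.Ico (L.first + 1) p, L.loop.delay k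

theorem first_lt : L.first < L.l := L.first_le_last.trans_lt L.last_lt

theorem loop_step {p : ℕ} (hp : p < L.l) :
    A.SummaryStep (L.loop.conf p) (L.loop.delay p) (L.loop.label p) (L.loop.conf (p + 1)) :=
  L.loop_asap.1 p (by rw [L.loop_len]; exact_mod_cast hp)

theorem forgetTime_eq (s : Config Q (Option C)) :
    s.forgetTime = ⟨s.loc, fun _ => s.val (some default)⟩ := by
  ext c
  · rfl
  · rw [Subsingleton.elim c default]
    rfl

theorem val_succ {p : ℕ} (hp : p < L.l) (hr : (L.loop.label p).reset = ∅) :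
    (L.loop.conf (p + 1)).val (some default) =
      (L.loop.conf p).val (some default) + L.loop.delay p := by
  have := (L.loop_step hp).step.2.2.2.2.2.1 default
  simpa [hr, Config.forgetTime, Config.wait] using this

theorem val_succ_of_reset {p : ℕ} (hp : p < L.l) (hr : (L.loop.label p).reset.Nonempty) :
    (L.loop.conf (p + 1)).val (some default) = 0 := by
  have := (L.loop_step hp).step.2.2.2.2.2.1 default
  obtain ⟨c, hc⟩ := hr
  rw [Subsingleton.elim c default] at hc
  simpa [hc, Config.forgetTime] using this

theorem val_of_le_first {p : ℕ} (hp : p ≤ L.first) :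
    (L.loop.conf p).val (some default) = L.v₀ + L.loop.elapsed p := by
  induction p with
  | zero => rw [L.loop_start, TimedPath.elapsed_zero, add_zero]; rfl
  | succ p ih =>
    rw [L.val_succ (by have := L.first_lt; omega) (L.before_first p hp), ih (by omega),
      TimedPath.elapsed_succ, add_assoc]

theorem val_loop_end : (L.loop.conf L.l).val (some default) = L.d₃ := by
  have h : ∀ p, L.last + 1 ≤ p → p ≤ L.l → (L.loop.conf p).val (some default) =
      ∑ k ∈ Finset.Ico (L.last + 1) p, L.loop.delay k := by
    intro p hp
    induction p, hp using Nat.le_induction with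
    | base =>
      intro _
      rw [L.val_succ_of_reset L.last_lt L.last_reset, Finset.Ico_self, Finset.sum_empty]
    | succ p hp ih =>
      intro hl
      rw [L.val_succ hl (L.after_last p hp hl), ih (by omega), Finset.sum_Ico_succ_top hp]
  exact h L.l L.last_lt le_rfl

theorem off_of_le {p : ℕ} (hp : p ≤ L.first + 1) : L.off p = 0 := by
  rw [off, Finset.Ico_eq_empty_of_le hp, Finset.sum_empty]

theorem off_succ {p : ℕ} (hp : L.first < p) : L.off (p + 1) = L.off p + L.loop.delay p :=
  Finset.sum_Ico_succ_top hp _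

theorem off_mono : Monotone L.off := fun _ _ hab =>
  Finset.sum_le_sum_of_subset (Finset.Ico_subset_Ico_right hab)

theorem off_end : L.off L.l = L.d₂ + L.d₃ :=
  (Finset.sum_Ico_consecutive _ (Nat.succ_le_succ L.first_le_last) L.last_lt).symm

theorem elapsed_le (p : ℕ) : L.loop.elapsed p ≤ L.loop.elapsed (L.first + 1) + L.off p := by
  rcases le_total p (L.first + 1) with h | h
  · exact (L.loop.elapsed_mono h).trans le_self_add
  · rw [TimedPath.elapsed, TimedPath.elapsed, off, Finset.range_eq_Ico, Finset.range_eq_Ico,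
      Finset.sum_Ico_consecutive _ (Nat.zero_le _) h]

theorem elapsed_first_add_le : L.loop.elapsed (L.first + 1) + (L.d₂ + L.d₃) + L.v₀ ≤ L.T := by
  have := L.total_le
  rw [← Finset.range_eq_Ico] at this
  rw [← add_assoc]
  exact this

theorem label_src {p : ℕ} (hp : p < L.l) : (L.loop.label p).src = (L.loop.conf p).loc :=
  (L.loop_step hp).step.2.2.1.symm

theorem inv_sat {p : ℕ} (hp : p < L.l) :
    (A.inv (L.loop.conf p).loc).Sat fun _ => (L.loop.conf p).val (some default) := by
  have := (L.loop_step hp).step.1.sat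
  rwa [forgetTime_eq] at this

theorem inv_sat_T {p : ℕ} (hp : p ≤ L.first) :
    (A.inv (L.loop.conf p).loc).Sat fun _ => L.T := by
  rw [← L.label_src (hp.trans_lt L.first_lt)]
  exact (L.T_attained p hp).1

theorem loc_zero : (L.loop.conf 0).loc = q := by
  rw [L.loop_start]
  exact L.stem_minimal.2.2.2.1

theorem canWait_of_le_first {p : ℕ} (hp : p ≤ L.first) {z a : ℝ≥0}
    (hz : (A.inv (L.loop.conf p).loc).Sat fun _ => z) (ha : z + a ≤ L.T) :
    A.CanWait ⟨(L.loop.conf p).loc, fun _ => z⟩ a := fun _ hδ =>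
  ClockConstraint.sat_of_mem_Icc hz (L.inv_sat_T hp) le_self_add
    ((add_le_add_right hδ z).trans ha)

/-- The configuration before step `p` of a lap that starts with clock value `z` and takes all steps
up to the first reset at the clock value `y`. -/
noncomputable def lapConf (z y : ℝ≥0) (p : ℕ) : Config Q C :=
  if p = 0 then ⟨q, fun _ => z⟩
  else if p ≤ L.first then ⟨(L.loop.conf p).loc, fun _ => y⟩ else (L.loop.conf p).forgetTime

/-- By convexity, the steps up to the first reset can be taken at any clock value between the one
of the as-soon-as-possible execution and `T`. -/
theorem fires_of_le_first {p : ℕ} (hp : p ≤ L.first) {z y : ℝ≥0}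
    (hy : L.v₀ + L.loop.elapsed (L.first + 1) ≤ y) (hT : y ≤ L.T) :
    A.Fires ⟨(L.loop.conf p).loc, fun _ => y⟩ (L.loop.label p) (L.lapConf z y (p + 1)) := by
  have hpl := hp.trans_lt L.first_lt
  obtain ⟨hτ, hsrc, hguard, htgt, hval, hinv⟩ := (L.loop_step hpl).step.2
  have hle : ∀ k ≤ L.first + 1, L.v₀ + L.loop.elapsed k ≤ y := fun k hk =>
    (add_le_add_right (L.loop.elapsed_mono hk) _).trans hy
  have hg : (L.loop.label p).guard.Sat fun _ => y := by
    refine ClockConstraint.sat_of_mem_Icc (a := L.v₀ + L.loop.elapsed (p + 1)) ?_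
      (L.T_attained p hp).2 (hle _ (by omega)) hT
    rw [forgetTime_eq] at hguard
    rw [TimedPath.elapsed_succ, ← add_assoc, ← L.val_of_le_first hp]
    exact hguard
  rw [lapConf, if_neg (Nat.succ_ne_zero p)]
  rcases hp.lt_or_eq with h | h
  · rw [if_pos (Nat.succ_le_of_lt h)]
    refine ⟨hτ, hsrc, hg, htgt, fun c => by simp [L.before_first p h], ?_⟩
    have h1 := L.inv_sat (Nat.lt_of_le_of_lt h L.first_lt)
    rw [L.val_of_le_first h] at h1
    exact ClockConstraint.sat_of_mem_Icc h1 (L.inv_sat_T h) (hle _ (by omega)) hT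
  · rw [if_neg (by omega)]
    refine ⟨hτ, hsrc, hg, htgt, fun c => ?_, hinv⟩
    have hr : (L.loop.label p).reset.Nonempty := h ▸ L.first_reset
    rw [Subsingleton.elim c default]
    refine (L.val_succ_of_reset hpl hr).trans (if_pos ?_).symm
    obtain ⟨c', hc'⟩ := hr
    rwa [Subsingleton.elim c' default] at hc'

/-- The delay before step `p` of a lap whose first step is delayed by `a`. -/
noncomputable def lapDelay (a : ℝ≥0) (p : ℕ) : ℝ≥0 :=
  if p = 0 then a else if p ≤ L.first then 0 else L.loop.delay p

theorem lap_step {z a y : ℝ≥0} (hz : (A.inv q).Sat fun _ => z) (hzy : z + a = y)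
    (hy : L.v₀ + L.loop.elapsed (L.first + 1) ≤ y) (hT : y ≤ L.T) {p : ℕ} (hp : p < L.l) :
    A.Step (L.lapConf z y p) (L.lapDelay a p) (L.loop.label p) (L.lapConf z y (p + 1)) := by
  rcases Nat.eq_zero_or_pos p with rfl | hp0
  · rw [lapDelay, if_pos rfl]
    have h0 : L.lapConf z y 0 = ⟨(L.loop.conf 0).loc, fun _ => z⟩ := by
      rw [lapConf, if_pos rfl, L.loc_zero]
    rw [h0]
    refine ⟨L.canWait_of_le_first (Nat.zero_le _) (by rwa [L.loc_zero]) (hzy.trans_le hT), ?_⟩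
    have := L.fires_of_le_first (Nat.zero_le _) (z := z) hy hT
    subst hzy
    exact this
  · rcases le_or_gt p L.first with h | h
    · have h0 : L.lapConf z y p = ⟨(L.loop.conf p).loc, fun _ => y⟩ := by
        rw [lapConf, if_neg hp0.ne', if_pos h]
      rw [lapDelay, if_neg hp0.ne', if_pos h, h0]
      refine ⟨L.canWait_of_le_first h ?_ ((add_zero y).trans_le hT), ?_⟩
      · have h1 := L.inv_sat hp
        rw [L.val_of_le_first h] at h1
        exact ClockConstraint.sat_of_mem_Icc h1 (L.inv_sat_T h)
          ((add_le_add_right (L.loop.elapsed_mono (by omega)) _).trans hy) hT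
      · rw [Config.wait_zero]
        exact L.fires_of_le_first h hy hT
    · rw [lapDelay, if_neg hp0.ne', if_neg (by omega), lapConf, if_neg hp0.ne', if_neg (by omega),
        lapConf, if_neg (by omega), if_neg (by omega)]
      exact (L.loop_step hp).step

/-- The time, from the end of the stem, at which lap `j` leaves `q`, if lap `0` does so at `D`. -/
noncomputable def dep (D : ℝ≥0) (j : ℕ) : ℝ≥0 := D + j * (L.T - L.d₃ + (L.d₂ + L.d₃))

/-- The time, from the end of the stem, at which lap `j` starts. -/
noncomputable def lapStart (D : ℝ≥0) : ℕ → ℝ≥0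
  | 0 => 0
  | j + 1 => L.dep D j + (L.d₂ + L.d₃)

/-- The clock value at the start of lap `j`. -/
noncomputable def lapVal : ℕ → ℝ≥0
  | 0 => L.v₀
  | _ + 1 => L.d₃

/-- The time that lap `j` stays in `q`. -/
noncomputable def lapStay (D : ℝ≥0) : ℕ → ℝ≥0
  | 0 => D
  | _ + 1 => L.T - L.d₃

theorem stay_pos : 0 < L.T - L.d₃ := tsub_pos_of_lt L.tail_lt

theorem lapStart_add (D : ℝ≥0) (j : ℕ) : L.lapStart D j + L.lapStay D j = L.dep D j := by
  cases j with
  | zero => simp [lapStart, lapStay, dep]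
  | succ j =>
    simp only [lapStart, lapStay, dep]
    push_cast
    ring

theorem dep_lt_succ (D : ℝ≥0) (j : ℕ) : L.dep D j + (L.d₂ + L.d₃) < L.dep D (j + 1) := by
  rw [← L.lapStart_add D (j + 1)]
  exact lt_add_of_pos_right _ L.stay_pos

theorem le_dep (D : ℝ≥0) (j : ℕ) : D ≤ L.dep D j := le_self_add

/-- Going through the loop again and again, the first time after a stay of `D` in `q`, and then
whenever the clock reaches `T`. Steps at a time of departure get the priority `R + 1 + c`, the other
ones the lower priority `R`. -/
noncomputable def laps {D : ℝ≥0} (hD : L.loop.elapsed (L.first + 1) ≤ D) (hT : L.v₀ + D ≤ L.T)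
    (R c : ℕ) : A.Laps (L.stem.conf L.n).forgetTime where
  l := L.l
  pos := L.first.zero_le.trans_lt L.first_lt
  conf j := L.lapConf (L.lapVal j) (L.lapVal j + L.lapStay D j)
  delay j := L.lapDelay (L.lapStay D j)
  label _ := L.loop.label
  prio _ p := if L.off (p + 1) = 0 then R + 1 + c else R
  clock j p := if p = 0 then L.lapStart D j else L.dep D j + L.off p
  start := by
    rw [lapConf, if_pos rfl, forgetTime_eq, L.stem_minimal.2.2.2.1]
    rfl
  step j p hp := by
    cases j with
    | zero =>
      refine L.lap_step ?_ rfl (add_le_add_right hD _) hT hp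
      have := L.inv_sat (L.first.zero_le.trans_lt L.first_lt)
      rwa [L.loc_zero, L.loop_start] at this
    | succ j =>
      have h : L.lapVal (j + 1) + L.lapStay D (j + 1) = L.T := add_tsub_cancel_of_le L.tail_lt.le
      refine L.lap_step ?_ rfl (((add_le_add_right hD _).trans hT).trans h.ge) h.le hp
      obtain ⟨k, hk⟩ := Nat.exists_eq_succ_of_ne_zero (L.first.zero_le.trans_lt L.first_lt).ne'
      have := (L.loop_step (show k < L.l by omega)).step.2.2.2.2.2.2
      rwa [← Nat.succ_eq_add_one, ← hk, forgetTime_eq, L.loop_end, L.val_loop_end] at this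
  conf_end j := by
    have := L.first_lt
    rw [lapConf, if_neg (by omega), if_neg (by omega), lapConf, if_pos rfl, forgetTime_eq,
      L.loop_end, L.val_loop_end]
    rfl
  clock_zero := rfl
  clock_succ j p hp := by
    rw [if_neg (Nat.succ_ne_zero p), lapDelay]
    rcases Nat.eq_zero_or_pos p with rfl | hp0
    · rw [if_pos rfl, if_pos rfl, L.off_of_le (by omega), add_zero, L.lapStart_add]
    · rw [if_neg hp0.ne', if_neg hp0.ne']
      split_ifs with h
      · rw [L.off_of_le (by omega), L.off_of_le (by omega), add_zero, add_zero]
      · rw [L.off_succ (by omega), add_assoc]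
  clock_end j := by
    rw [if_neg (by have := L.first_lt; omega), if_pos rfl, L.off_end]
    rfl
  key_le_succ j p hp := by
    simp only [Nat.succ_ne_zero, if_false]
    rcases (L.off_mono (Nat.le_succ (p + 1))).lt_or_eq with h | h
    · exact Prod.Lex.toLex_le_toLex.2 (Or.inl (by simpa using h))
    · exact (by rw [h] : _ = _).le
  key_le_next j := by
    have := L.first_lt
    refine Prod.Lex.toLex_le_toLex.2 (Or.inl ?_)
    simp only [if_neg (show L.l ≠ 0 by omega), Nat.one_ne_zero, if_false]
    rw [L.off_end, L.off_of_le (show 1 ≤ L.first + 1 by omega), add_zero]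
    exact L.dep_lt_succ D j
  unbounded t := by
    obtain ⟨j, hj⟩ := Archimedean.arch t L.stay_pos
    refine ⟨j + 1, ?_⟩
    simp only [Nat.one_ne_zero, if_false]
    rw [L.off_of_le (show 1 ≤ L.first + 1 by omega), add_zero]
    refine lt_of_le_of_lt ?_ ((le_self_add).trans_lt (L.dep_lt_succ D j))
    rw [nsmul_eq_mul] at hj
    rw [dep]
    exact hj.trans ((mul_le_mul_right le_self_add _).trans le_add_self)

/-- One of the processes that flood `q`: it arrives there at the minimal reachability time and goes
through the laps that leave `q` at the times `L.dep D j`. -/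
theorem exists_lap_script {D : ℝ≥0} (hD : L.loop.elapsed (L.first + 1) ≤ D)
    (hT : L.v₀ + D ≤ L.T) {R : ℕ} (hR : ∀ γ, ord γ < R) (c : ℕ) :
    ∃ S : A.Script A.initConfig, S.GuardsReady ord 0 ∧
      (∀ t p, ord q < p → (toLex (t, p) : ℝ≥0 ×ₗ ℕ) < toLex (L.dep D 0, R + 1 + c) →
        S.Occupies q (toLex (A.minReach q + t, p))) ∧
      ∀ j t p, ord q < p →
        (toLex (L.dep D j + (L.d₂ + L.d₃), if L.d₂ + L.d₃ = 0 then R + 1 + c else R) : ℝ≥0 ×ₗ ℕ) <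
          toLex (t, p) →
        (toLex (t, p) : ℝ≥0 ×ₗ ℕ) < toLex (L.dep D (j + 1), R + 1 + c) →
        S.Occupies q (toLex (A.minReach q + t, p)) := by
  have hfl := L.first_lt
  have h1 : L.off 1 = 0 := L.off_of_le (by omega)
  let Λ := L.laps hD hT R c
  have hclock : ∀ j p, Λ.clock j (p + 1) = L.dep D j + L.off (p + 1) := fun j p =>
    if_neg (t := L.lapStart D j) (Nat.succ_ne_zero p)
  have hkey1 : ∀ j, (toLex (Λ.clock j 1, Λ.prio j 0) : ℝ≥0 ×ₗ ℕ) =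
      toLex (L.dep D j, R + 1 + c) := fun j => by
    have h2 : Λ.prio j 0 = R + 1 + c := if_pos h1
    rw [hclock, h2, h1, add_zero]
  have hkeyl : ∀ j, (toLex (Λ.clock j Λ.l, Λ.prio j (Λ.l - 1)) : ℝ≥0 ×ₗ ℕ) =
      toLex (L.dep D j + (L.d₂ + L.d₃), if L.d₂ + L.d₃ = 0 then R + 1 + c else R) := fun j => by
    have h2 : Λ.l - 1 + 1 = L.l := Nat.sub_add_cancel Λ.pos
    have h3 : Λ.clock j Λ.l = L.dep D j + L.off L.l := if_neg (by change L.l ≠ 0; omega)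
    have h4 : Λ.prio j (Λ.l - 1) = if L.off (Λ.l - 1 + 1) = 0 then R + 1 + c else R := rfl
    rw [h3, h4, h2, L.off_end]
  have hkey0 : toLex (0, ord q) ≤ Λ.script.key 0 := by
    rw [Λ.key_script]
    simp only [Nat.zero_div, Nat.zero_mod, zero_add]
    rw [hkey1]
    exact Prod.Lex.toLex_mono ⟨zero_le, ((hR q).trans_le (by omega)).le⟩
  have hready : Λ.script.GuardsReady ord (A.minReach q) := by
    intro N γ hγ
    set p := N % Λ.l with hp
    have hpl : p < L.l := Nat.mod_lt N Λ.pos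
    obtain ⟨hg1, hg2⟩ := (L.loop_step hpl).locGuard (show (L.loop.label p).locGuard = some γ from hγ)
    refine ⟨hg1, hg2.trans ?_, (hR γ).trans_le ?_⟩
    · have h0 : (L.loop.conf 0).val none = A.minReach q := by
        obtain ⟨hlen, h0, hfol, -, hmin, -⟩ := L.stem_minimal
        rw [L.loop_start, val_none_eq_elapsed hfol hlen.ge, h0, hmin]
        exact zero_add _
      rw [val_none_eq_elapsed L.loop_asap.1 (by rw [L.loop_len]; exact_mod_cast hpl.le), h0,
        add_assoc, ← TimedPath.elapsed_succ]
      refine add_le_add_right ?_ _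
      have h2 : Λ.script.path.elapsed (N + 1) = Λ.clock (N / Λ.l) (p + 1) :=
        Λ.elapsed_path_succ N
      rw [h2, hclock]
      exact (L.elapsed_le _).trans (add_le_add_left (hD.trans (L.le_dep D _)) _)
    · change R ≤ if L.off (p + 1) = 0 then R + 1 + c else R
      split_ifs <;> omega
  obtain ⟨S, hS, hocc⟩ := L.stem_minimal.exists_script Λ.script hkey0 hready
  refine ⟨S, hS, fun t p hp h => ?_, fun j t p hp ha hb => ?_⟩
  · refine hocc q t p hp ?_
    have := Λ.occupies_first (κ := toLex (t, p)) (by rwa [hkey1])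
    rwa [show (L.stem.conf L.n).forgetTime.loc = q from L.stem_minimal.2.2.2.1] at this
  · refine hocc q t p hp ?_
    exact Λ.occupies_next (κ := toLex (t, p)) j (by rwa [hkeyl]) (by rwa [hkey1])

end GTA.FloodingLasso

namespace GTA

variable {Q C : Type*} {A : GTA Q C}

/-! ### Flooding a location with a lasso -/

/-- The departure times of `w` processes, process `k` leaving at the times `dep k j` and returning
`e` later, leave no gap: at every moment after the first departure of process `0` some process is
in between a return and its next departure. At equal times, processes with larger index act
first. -/
theorem exists_between_departures {s e b : ℝ≥0} (hs : 0 < s) {w : ℕ} (hw : 2 ≤ w)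
    (hcover : s + e ≤ w * s) (R : ℕ) {dep : ℕ → ℕ → ℝ≥0}
    (h0 : ∀ j : ℕ, dep 0 j = b + e + j * (s + e))
    (hsucc : ∀ k j : ℕ, dep (k + 1) j = b + k * s + j * (s + e)) {κ : ℝ≥0 ×ₗ ℕ}
    (hκ : toLex (dep 0 0, R + 1 + w) ≤ κ) :
    ∃ k < w, ∃ j,
      (toLex (dep k j + e, if e = 0 then R + 1 + (w - k) else R) : ℝ≥0 ×ₗ ℕ) < κ ∧
      κ < toLex (dep k (j + 1), R + 1 + (w - k)) := by
  classical
  let α : ℕ → ℕ → ℝ≥0 ×ₗ ℕ := fun k j => toLex (b + e + k * s + j * (s + e), R + 1 + (w - k))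
  have hα0 : ∀ j, α 0 j = toLex (dep 0 j, R + 1 + (w - 0)) := fun j => by simp [α, h0]
  have hα1 : ∀ k j, α (k + 1) j = toLex (dep (k + 1) (j + 1), R + 1 + (w - (k + 1))) :=
    fun k j => by
      simp only [α, hsucc]
      congr 2
      push_cast
      ring
  have hJ : ∃ j, κ < α 0 j := by
    obtain ⟨j, hj⟩ := Archimedean.arch (ofLex κ).1 hs
    refine ⟨j + 1, Prod.Lex.lt_iff.2 (Or.inl ?_)⟩
    rw [nsmul_eq_mul] at hj
    have h2 : (j : ℝ≥0) * s + s ≤ b + e + ((0 : ℕ) : ℝ≥0) * s + ((j + 1 : ℕ) : ℝ≥0) * (s + e) := by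
      rw [show (j : ℝ≥0) * s + s = ((j + 1 : ℕ) : ℝ≥0) * s by push_cast; ring]
      exact (mul_le_mul_right le_self_add _).trans le_add_self
    exact (hj.trans_lt (lt_add_of_pos_right _ hs)).trans_le h2
  obtain ⟨J, hJ1⟩ : ∃ J, Nat.find hJ = J + 1 := Nat.exists_eq_succ_of_ne_zero fun h => by
    have := Nat.find_spec hJ
    rw [h, hα0] at this
    exact absurd hκ this.not_ge
  have hJlt : κ < α 0 (J + 1) := hJ1 ▸ Nat.find_spec hJ
  have hJle : α 0 J ≤ κ := not_lt.1 (Nat.find_min hJ (by omega))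
  have hK : ∃ k, w ≤ k ∨ κ < α k J := ⟨w, Or.inl le_rfl⟩
  obtain ⟨k, hk1⟩ : ∃ k, Nat.find hK = k + 1 := Nat.exists_eq_succ_of_ne_zero fun h => by
    have := Nat.find_spec hK
    rw [h] at this
    rcases this with h | h
    · omega
    · exact absurd hJle h.not_ge
  have hmin := Nat.find_min hK (show k < Nat.find hK by omega)
  push Not at hmin
  obtain ⟨hkw, hkle⟩ := hmin
  have hspec := Nat.find_spec hK
  rw [hk1] at hspec
  rcases lt_or_ge (k + 1) w with h | h
  · have hlt : κ < α (k + 1) J := hspec.resolve_left (by omega)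
    refine ⟨k + 1, h, J, lt_of_lt_of_le ?_ hkle, by rwa [← hα1]⟩
    refine Prod.Lex.toLex_lt_toLex.2 (Or.inr ⟨?_, ?_⟩)
    · simp only [hsucc]
      ring
    · dsimp only
      split_ifs <;> omega
  · obtain rfl : w = k + 1 := by omega
    refine ⟨0, by omega, J, lt_of_lt_of_le ?_ hkle, by rwa [← hα0]⟩
    have he : e ≤ k * s := by
      push_cast at hcover
      rw [add_mul, one_mul, add_comm] at hcover
      exact le_of_add_le_add_right hcover
    have hdep : dep 0 J + e ≤ b + e + k * s + J * (s + e) := by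
      rw [h0, add_right_comm]
      gcongr
    rcases hdep.lt_or_eq with h1 | h1
    · exact Prod.Lex.toLex_lt_toLex.2 (Or.inl h1)
    · refine Prod.Lex.toLex_lt_toLex.2 (Or.inr ⟨h1, ?_⟩)
      have he0 : e ≠ 0 := by
        -- If `e = 0`, then `k * s > 0` makes process `0` come back strictly earlier.
        rintro rfl
        rw [h0] at h1
        have h2 : (k : ℝ≥0) * s = 0 := by
          refine (add_left_cancel (a := b + J * s) ?_).symm
          calc b + J * s + 0 = b + 0 + J * (s + 0) + 0 := by ring
            _ = b + 0 + k * s + J * (s + 0) := h1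
            _ = b + J * s + k * s := by ring
        rcases mul_eq_zero.1 h2 with h3 | h3
        · have : k = 0 := by exact_mod_cast h3
          omega
        · exact hs.ne' h3
      rw [if_neg he0]
      dsimp only
      omega

namespace FloodingLasso

variable [Unique C] {ord : Q → ℕ} {q : Q} (L : A.FloodingLasso ord q)

theorem two_le_width : 2 ≤ L.width := le_max_left _ _

theorem coe_stay : ((L.T - L.d₃ : ℝ≥0) : ℝ) = L.T - L.d₃ := NNReal.coe_sub L.tail_lt.le

theorem le_width_mul : L.T - L.d₃ + (L.d₂ + L.d₃) ≤ L.width * (L.T - L.d₃) := by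
  have hs : (0 : ℝ) < L.T - L.d₃ := sub_pos.2 L.tail_lt
  rw [← NNReal.coe_le_coe]
  push_cast [L.coe_stay]
  have h1 : ((L.T : ℝ) + L.d₂) / (L.T - L.d₃) ≤ L.width :=
    (Nat.le_ceil _).trans (Nat.cast_le.2 (le_max_right _ _))
  rw [div_le_iff₀ hs] at h1
  linarith

theorem mul_stay_le {k : ℕ} (hk : k + 1 < L.width) : k * (L.T - L.d₃) ≤ L.d₂ + L.d₃ := by
  have hs : (0 : ℝ) < L.T - L.d₃ := sub_pos.2 L.tail_lt
  rcases Nat.eq_zero_or_pos k with rfl | hk0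
  · simp
  have h1 : k + 1 < ⌈((L.T : ℝ) + L.d₂) / (L.T - L.d₃)⌉₊ := by
    rcases lt_max_iff.1 hk with h | h
    · omega
    · exact h
  have h2 := Nat.lt_ceil.1 h1
  rw [lt_div_iff₀ hs] at h2
  rw [← NNReal.coe_le_coe]
  push_cast [L.coe_stay] at h2 ⊢
  linarith

theorem exists_flooding_scripts {R : ℕ} (hR : ∀ γ, ord γ < R) :
    ∃ S : Fin L.width → A.Script A.initConfig, (∀ k, (S k).GuardsReady ord 0) ∧
      ∀ t p, A.minReach q ≤ t → ord q < p → ∃ k, (S k).Occupies q (toLex (t, p)) := by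
  obtain ⟨r, hr⟩ := exists_add_of_le L.elapsed_first_add_le
  set d₁ := L.loop.elapsed (L.first + 1)
  set e := L.d₂ + L.d₃
  set s := L.T - L.d₃
  -- The first departures: process `0` leaves `q` as late as possible, and process `k + 1` comes
  -- back when process `k` leaves.
  let D : ℕ → ℝ≥0 := fun k => Nat.casesOn k (d₁ + r + e) fun k => d₁ + r + k * s
  have hD : ∀ k < L.width, d₁ ≤ D k ∧ L.v₀ + D k ≤ L.T := by
    have h0 : L.v₀ + (d₁ + r + e) = L.T := by
      rw [hr]
      ring
    rintro (_ | k) hk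
    · exact ⟨le_self_add.trans le_self_add, h0.le⟩
    · refine ⟨le_self_add.trans le_self_add, le_trans ?_ h0.le⟩
      change L.v₀ + (d₁ + r + k * s) ≤ _
      gcongr
      exact L.mul_stay_le hk
  choose S hS hfirst hnext using fun k : Fin L.width =>
    L.exists_lap_script (hD k k.2).1 (hD k k.2).2 hR (L.width - k)
  refine ⟨S, hS, fun t p ht hp => ?_⟩
  obtain ⟨u, rfl⟩ := exists_add_of_le ht
  rcases lt_or_ge (toLex (u, p) : ℝ≥0 ×ₗ ℕ) (toLex (L.dep (D 0) 0, R + 1 + L.width)) with h | h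
  · exact ⟨⟨0, by have := L.two_le_width; omega⟩, hfirst _ u p hp h⟩
  · obtain ⟨k, hk, j, h1, h2⟩ := exists_between_departures (b := d₁ + r) L.stay_pos L.two_le_width
      L.le_width_mul R (dep := fun k j => L.dep (D k) j) (fun j => rfl) (fun k j => rfl) h
    exact ⟨⟨k, hk⟩, hnext ⟨k, hk⟩ j u p hp h1 h2⟩

end FloodingLasso

/-! ### Projected computations -/

theorem minReach_le_elapsed {n : ℕ} (hn : 0 < n) {π : NPath Q C n} (hπ : π ∈ A.language n) {k : ℕ}
    (hk : (k : ℕ∞) ≤ π.len) {i : Fin n} {γ : Q} (hi : (π.conf k i).loc = γ) :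
    A.minReach γ ≤ π.elapsed k := by
  refine csInf_le (OrderBot.bddBelow _) ⟨n, hn, ⟨k, π.conf, π.delay, π.label⟩, ⟨hπ.1, ?_⟩, k,
    ⟨⟨le_rfl, le_rfl⟩, fun j hj => Nat.cast_le.1 hj.1⟩, i, hi⟩
  exact fun j hj => hπ.2 j (lt_of_lt_of_le hj hk)

section Projection

variable {m n : ℕ} {h : m ≤ n} {π : NPath Q C n} {ρ : NPath Q C m}

theorem IsProjection.elapsed_eq (hp : IsProjection h π ρ) {k : ℕ} (hk : (k : ℕ∞) ≤ π.len) :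
    ρ.elapsed k = π.elapsed k := by
  refine Finset.sum_congr rfl fun i hi => ?_
  exact (hp.2.2 i (lt_of_lt_of_le (by exact_mod_cast Finset.mem_range.1 hi) hk)).1

/-- The stuttering steps that stand for steps of other processes are steps of the first `m`
processes in their own right. -/
theorem IsProjection.follows (hp : IsProjection h π ρ) (hπ : π ∈ A.language n) :
    ρ.Follows (A.FreeStep m) := by
  intro k hk
  obtain ⟨hlen, hconf, hlab⟩ := hp
  rw [hlen] at hk
  have hk' : ((k + 1 : ℕ) : ℕ∞) ≤ π.len := by
    push_cast
    exact Order.add_one_le_of_lt hk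
  obtain ⟨hwait, hfire, -, hrest⟩ := hπ.2 k hk
  obtain ⟨hdel, hl⟩ := hlab k hk
  have hwait' : ∀ i, A.CanWait (ρ.conf k i) (ρ.delay k) := fun i => by
    rw [hconf k hk.le, hdel]
    exact hwait _
  refine ⟨hwait', ?_, fun j hj => ?_⟩
  · rcases hl with ⟨hl1, hl2⟩ | ⟨hl1, hl2⟩
    · rw [hconf k hk.le, hconf _ hk', hl1, hl2, hdel]
      exact hfire
    · have heq : ρ.conf (k + 1) (ρ.label k).1 = (ρ.conf k (ρ.label k).1).wait (ρ.delay k) := by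
        rw [hconf k hk.le, hconf _ hk', hdel]
        exact hrest _ (hl1 _)
      rw [hl2, heq]
      exact fires_stutter (hwait' _ _ le_rfl)
  · rw [hconf k hk.le, hconf _ hk', hdel]
    refine hrest _ ?_
    rcases hl with ⟨hl1, -⟩ | ⟨hl1, -⟩
    · rw [← hl1]
      exact fun h' => hj (Fin.castLE_injective h h')
    · exact hl1 j

theorem IsProjection.locGuard (hp : IsProjection h π ρ) (hπ : π ∈ A.language n) {k : ℕ}
    (hk : (k : ℕ∞) < ρ.len) {γ : Q} (hγ : (ρ.label k).2.locGuard = some γ) :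
    γ ∈ A.rGuards ∧ A.minReach γ ≤ ρ.elapsed (k + 1) := by
  have hfree := (hp.follows hπ k hk).2.1.1
  rw [hp.1] at hk
  obtain ⟨-, hl⟩ := hp.2.2 k hk
  have hl2 : (ρ.label k).2 = (π.label k).2 := by
    rcases hl with ⟨-, hl⟩ | ⟨-, hl⟩
    · exact hl
    · rw [hl] at hγ
      cases hγ
  obtain ⟨-, -, hocc, -⟩ := hπ.2 k hk
  obtain ⟨i, -, hi⟩ := hocc γ (hl2 ▸ hγ)
  have hn : 0 < n := i.pos
  refine ⟨⟨?_, n, hn, π, hπ, k, hk.le, i, hi⟩, ?_⟩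
  · rcases hfree with ht | ⟨q, hq⟩
    · exact ⟨_, ht, hγ⟩
    · rw [hq] at hγ
      cases hγ
  · refine (minReach_le_elapsed hn hπ hk.le hi).trans ?_
    rw [← hp.elapsed_eq hk.le]
    exact ρ.elapsed_mono (Nat.le_succ k)

end Projection

/-- A family of scripts that floods every reachable guard can replace all other processes. -/
theorem projLanguage_subset_of_flooding {ord : Q → ℕ} {M : ℕ} (hM : ∀ γ, ord γ < M) {m n W : ℕ}
    (S : Fin W → A.Script A.initConfig) (hS : ∀ i, (S i).GuardsReady ord 0)
    (hocc : ∀ γ ∈ A.rGuards, ∀ t p, A.minReach γ ≤ t → ord γ < p →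
      ∃ i, (S i).Occupies γ (toLex (t, p))) :
    A.projLanguage m n ⊆ A.projLanguage m (m + W) := by
  rintro ρ ⟨h, π, hπ, ρ', hp, hexp⟩
  have h0 : ρ'.conf 0 = fun _ => A.initConfig := by
    funext i
    rw [hp.2.1 0 zero_le, hπ.1]
  obtain ⟨h', π', hπ', ρ'', hp', hexp'⟩ := mem_projLanguage_of_scripts ρ' S M (ρ.label 0).1.pos h0
    (hp.follows hπ)
    (fun k hk γ hγ => by
      obtain ⟨h1, h2⟩ := hp.locGuard hπ hk hγ
      exact hocc γ h1 _ _ h2 (hM γ))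
    (fun i k γ hγ => by
      obtain ⟨h1, h2, h3⟩ := hS i k γ hγ
      rw [zero_add] at h2
      exact hocc γ h1 _ _ h2 h3)
  exact ⟨h', π', hπ', ρ'', hp', hexp.trans hexp'⟩

end GTA

theorem mainTheorem5 {Q C : Type*} [Fintype Q] [Unique C] (A : GTA Q C) (ord : Q → ℕ)
    (hmin : ∀ q ∈ A.rGuards, A.inv q = .top → ∃ ρ n, A.IsMinimalRun ord q ρ n)
    (lasso : ∀ q ∈ A.rGuards, A.inv q ≠ .top → A.FloodingLasso ord q) (m : ℕ) :
    GTA.IsCutoff {A} m (m + ∑ q ∈ A.rGuardsFinset, A.width lasso q) := by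
  intro A' hA'
  rw [Set.mem_singleton_iff.1 hA']
  have hR : ∀ γ, ord γ < Finset.univ.sup ord + 1 := fun γ =>
    Nat.lt_succ_iff.2 (Finset.le_sup (Finset.mem_univ γ))
  have hflood : ∀ q : A.rGuardsFinset, ∃ S : Fin (A.width lasso q) → A.Script A.initConfig,
      (∀ k, (S k).GuardsReady ord 0) ∧
      ∀ t p, A.minReach q ≤ t → ord q < p → ∃ k, (S k).Occupies q.1 (toLex (t, p)) := by
    rintro ⟨q, hq⟩
    have hq' : q ∈ A.rGuards := by simpa [GTA.rGuardsFinset] using hq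
    by_cases hi : A.inv q = .top
    · obtain ⟨ρ, n, hρ⟩ := hmin q hq' hi
      obtain ⟨S, hS, hocc⟩ := hρ.exists_flooding_script hi
      have hw : A.width lasso q = 1 := by rw [GTA.width, dif_pos hi]
      exact ⟨fun _ => S, fun _ => hS, fun t p ht hp => ⟨⟨0, by rw [hw]; exact one_pos⟩,
        hocc t p ht hp⟩⟩
    · have hw : A.width lasso q = (lasso q hq' hi).width := by
        rw [GTA.width, dif_neg hi, dif_pos hq']
      dsimp only
      rw [hw]
      exact (lasso q hq' hi).exists_flooding_scripts hR
  choose S hS hocc using hflood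
  have hcard : Fintype.card (Σ q : A.rGuardsFinset, Fin (A.width lasso q)) =
      ∑ q ∈ A.rGuardsFinset, A.width lasso q := by
    rw [Fintype.card_sigma]
    simp only [Fintype.card_fin]
    exact Finset.sum_coe_sort A.rGuardsFinset fun q => A.width lasso q
  let e := Fintype.equivFinOfCardEq hcard
  refine Set.Subset.antisymm (Set.iUnion_subset fun n => ?_) fun ρ hρ => ?_
  · refine GTA.projLanguage_subset_of_flooding hR (fun i => S (e.symm i).1 (e.symm i).2)
      (fun i => hS _ _) fun γ hγ t p ht hp => ?_
    obtain ⟨k, hk⟩ := hocc ⟨γ, by simpa [GTA.rGuardsFinset] using hγ⟩ t p ht hp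
    exact ⟨e ⟨_, k⟩, by rwa [Equiv.symm_apply_apply]⟩
  · -- The network is non-empty: a sequence of `NPath Q C m` exists only for `m > 0`.
    exact Set.mem_iUnion.2 ⟨⟨_, Nat.add_pos_left (ρ.label 0).1.pos _⟩, hρ⟩
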